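/- Let $\Gamma$ be a torsionless grading monoid (a commutative, cancellative additive monoid whose quotient group $\langle\Gamma\rangle=\{a-b\mid a,b\in\Gamma\}$ is torsion-free), let $R=\bigoplus_{\alpha\in\Gamma}R_\alpha$ be a $\Gamma$-graded integral domain with quotient field $K$, let $H$ be the set of nonzero homogeneous elements of $R$, and let $R_H=\bigoplus_{\alpha\in\langle\Gamma\rangle}(R_H)_\alpha\subseteq K$ be the localization of $R$ at $H$ with its natural grading. A semistar operation on an integral domain $D$ with quotient field $K$ is a map $E\mapsto E^\star$ from the set of nonzero $D$-submodules of $K$ to itself such that, for all $0\neq x\in K$ and all $E,F$: $(xE)^\star=xE^\star$; $E\subseteq F$ implies $E^\star\subseteq F^\star$; $E\subseteq E^\star$ and $(E^\star)^\star=E^\star$. Put $E^{\star_f}=\bigcup\{F^\star\mid 0\neq F\subseteq E,\ F \text{ finitely generated}\}$ and $E^{-1}=\{x\in K\mid xE\subseteq D\}$. Let $d$ be the identity operation, $E^v=(E^{-1})^{-1}$, and $t=v_f$. A nonzero finitely generated $D$-submodule $E$ of $K$ is $\star_f$-invertible if $(EE^{-1})^{\star_f}=D^\star$. The domain $D$ is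 a P$v$MD if every nonzero finitely generated $D$-submodule of $K$ is $t$-invertible (that is, $v_f$-invertible). A graded domain $D$ is a graded P$\star$MD if every nonzero finitely generated homogeneous ideal of $D$ is $\star_f$-invertible; it is a graded Prüfer domain if it is a graded P$d$MD. A homogeneous overring of $R$ is a ring $T$ with $R\subseteq T\subseteq R_H$ and $T=\bigoplus_{\alpha\in\langle\Gamma\rangle}(T\cap (R_H)_\alpha)$; it is graded by $T_\alpha=T\cap(R_H)_\alpha$. Given semistar operations $\star$ on $R$ and $\star'$ on $T$, a homogeneous overring $T$ is called homogeneously $(\star,\star')$-linked if, for every nonzero finitely generated homogeneous ideal $F$ of $R$, $F^\star=R^\star$ implies $(FT)^{\star'}=T^{\star'}$. **Theorem.** Suppose that $R$ has a unit of nonzero degree, and let $\star$ be a semistar operation on $R$ with $R^\star\subsetneq R_H$. Then the following statements are equivalent: 1. $R$ is a graded P$\star$MD. 2. Each homogeneously $(\star,t)$-linked overring of $R$ is a P$v$MD. 3. Each homogeneously $(\star,d)$-linked overring of $R$ is a graded Prüfer domain. 4. Each homogeneously $(\star,t)$-linked overring of $R$ is integrally closed. 5. Each homogeneously $(\star,d)$-linked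 overring of $R$ is integrally closed. -/

import Mathlib

open scoped Pointwise

/-- A semistar operation on an integral domain `D` with quotient field `K`: a self-map `E ↦ E^⋆` of
the set of nonzero `D`-submodules of `K` with the usual three axioms. The map is extended to the
zero submodule by `0^⋆ = 0`, so that it is a total function (a nonzero `E` is sent to a
nonzero submodule because `E ⊆ E^⋆`). -/
structure SemistarOperation (D K : Type*) [CommRing D] [Field K] [Algebra D K] where
  toFun : Submodule D K → Submodule D K
  map_bot : toFun ⊥ = ⊥
  map_smul : ∀ (x : K), x ≠ 0 → ∀ E : Submodule D K, E ≠ ⊥ → toFun (x • E) = x • toFun E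
  mono : ∀ E F : Submodule D K, E ≠ ⊥ → E ≤ F → toFun E ≤ toFun F
  le_apply : ∀ E : Submodule D K, E ≠ ⊥ → E ≤ toFun E
  idem : ∀ E : Submodule D K, E ≠ ⊥ → toFun (toFun E) = toFun E

namespace SemistarOperation

section

variable {D K : Type*} [CommRing D] [Field K] [Algebra D K]

instance : CoeFun (SemistarOperation D K) (fun _ => Submodule D K → Submodule D K) := ⟨toFun⟩

theorem monotone (s : SemistarOperation D K) {E F : Submodule D K} (h : E ≤ F) : s E ≤ s F := by
  by_cases hE : E = ⊥
  · subst hE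
    rw [s.map_bot]
    exact bot_le
  · exact s.mono E F hE h

theorem le_self (s : SemistarOperation D K) (E : Submodule D K) : E ≤ s E := by
  by_cases hE : E = ⊥
  · subst hE
    exact bot_le
  · exact s.le_apply E hE

theorem apply_apply (s : SemistarOperation D K) (E : Submodule D K) : s (s E) = s E := by
  by_cases hE : E = ⊥
  · subst hE
    rw [s.map_bot, s.map_bot]
  · exact s.idem E hE

theorem apply_smul (s : SemistarOperation D K) {x : K} (hx : x ≠ 0) (E : Submodule D K) :
    s (x • E) = x • s E := by
  by_cases hE : E = ⊥
  · subst hE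
    rw [s.map_bot, Submodule.smul_bot', s.map_bot]
  · exact s.map_smul x hx E hE

theorem exists_fg_le (s : SemistarOperation D K) {E G : Submodule D K}
    (h : ∀ x ∈ G, ∃ F : Submodule D K, F.FG ∧ F ≤ E ∧ x ∈ s F) (hG : G.FG) :
    ∃ F : Submodule D K, F.FG ∧ F ≤ E ∧ G ≤ s F := by
  obtain ⟨S, rfl⟩ := hG
  choose! φ hφ using fun x (hx : x ∈ S) => h x (Submodule.subset_span hx)
  refine ⟨⨆ x ∈ S, φ x, Submodule.fg_biSup S _ fun x hx => (hφ x hx).1,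
    iSup₂_le fun x hx => (hφ x hx).2.1, Submodule.span_le.2 fun x hx => ?_⟩
  exact s.monotone (le_iSup₂_of_le x hx le_rfl) (hφ x hx).2.2

/-- The semistar operation of finite type `⋆_f` associated to `⋆`: `E^{⋆_f}` is the union of the
`F^⋆` over the finitely generated `F ⊆ E`. (Allowing `F = 0` adds only the element `0`.) -/
def finiteType (s : SemistarOperation D K) : SemistarOperation D K where
  toFun E :=
    { carrier := {x | ∃ F : Submodule D K, F.FG ∧ F ≤ E ∧ x ∈ s F}
      zero_mem' := ⟨⊥, Submodule.fg_bot, bot_le, Submodule.zero_mem _⟩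
      add_mem' := by
        rintro a b ⟨F, hF, hFE, ha⟩ ⟨G, hG, hGE, hb⟩
        exact ⟨F ⊔ G, hF.sup hG, sup_le hFE hGE,
          Submodule.add_mem _ (s.monotone le_sup_left ha) (s.monotone le_sup_right hb)⟩
      smul_mem' := by
        rintro c a ⟨F, hF, hFE, ha⟩
        exact ⟨F, hF, hFE, Submodule.smul_mem _ c ha⟩ }
  map_bot := by
    refine le_antisymm ?_ bot_le
    rintro x ⟨F, -, hF, hx⟩
    rwa [le_bot_iff.1 hF, s.map_bot] at hx
  map_smul x hx E _ := by
    have key : ∀ (y : K), y ≠ 0 → ∀ (F : Submodule D K), F.FG → (y • F).FG := fun y _ F hF =>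
      hF.map (DistribSMul.toLinearMap D K y)
    ext z
    constructor
    · rintro ⟨F, hF, hFE, hz⟩
      refine ⟨x⁻¹ * z, ⟨x⁻¹ • F, key _ (inv_ne_zero hx) F hF, ?_, ?_⟩, ?_⟩
      · rintro _ ⟨w, hw, rfl⟩
        obtain ⟨e, he, rfl⟩ := hFE hw
        simpa [hx] using he
      · rw [s.apply_smul (inv_ne_zero hx)]
        exact ⟨z, hz, rfl⟩
      · simp [hx]
    · rintro ⟨w, ⟨F, hF, hFE, hw⟩, rfl⟩
      refine ⟨x • F, key x hx F hF, Submodule.map_mono hFE, ?_⟩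
      rw [s.apply_smul hx]
      exact ⟨w, hw, rfl⟩
  mono E F _ h := by
    rintro x ⟨G, hG, hGE, hx⟩
    exact ⟨G, hG, hGE.trans h, hx⟩
  le_apply E _ := by
    intro x hx
    exact ⟨Submodule.span D {x}, Submodule.fg_span_singleton x,
      (Submodule.span_singleton_le_iff_mem x E).2 hx,
      s.le_self _ (Submodule.mem_span_singleton_self x)⟩
  idem E _ := by
    ext x
    constructor
    · rintro ⟨G, hG, hGE, hx⟩
      obtain ⟨F, hF, hFE, hGF⟩ := s.exists_fg_le (E := E) (fun y hy => hGE hy) hG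
      refine ⟨F, hF, hFE, ?_⟩
      rw [← s.apply_apply F]
      exact s.monotone hGF hx
    · rintro ⟨F, hF, hFE, hx⟩
      refine ⟨F, hF, fun y hy => ?_, hx⟩
      exact ⟨F, hF, hFE, s.le_self F hy⟩

end

section

variable (D K : Type*) [CommRing D] [Field K] [Algebra D K]

/-- The identity semistar operation `d`. -/
def d : SemistarOperation D K where
  toFun E := E
  map_bot := rfl
  map_smul _ _ _ _ := rfl
  mono _ _ _ h := h
  le_apply _ _ := le_rfl
  idem _ _ := rfl

variable {D K} in
theorem one_div_smul {x : K} (hx : x ≠ 0) (E : Submodule D K) :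
    (1 : Submodule D K) / (x • E) = x⁻¹ • ((1 : Submodule D K) / E) := by
  ext z
  constructor
  · intro hz
    refine ⟨x * z, fun y hy => ?_, ?_⟩
    · have := hz (x * y) ⟨y, hy, rfl⟩
      rwa [mul_left_comm, ← mul_assoc] at this
    · simp [hx]
  · rintro ⟨w, hw, rfl⟩ _ ⟨y, hy, rfl⟩
    have := hw y hy
    have e : x⁻¹ * w * (x * y) = w * y := by field_simp
    simpa [e] using this

variable {D K} in
theorem le_one_div_one_div (E : Submodule D K) :
    E ≤ (1 : Submodule D K) / ((1 : Submodule D K) / E) := by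
  intro x hx y hy
  rw [mul_comm]
  exact hy x hx

variable {D K} in
theorem one_div_anti {E F : Submodule D K} (h : E ≤ F) :
    (1 : Submodule D K) / F ≤ (1 : Submodule D K) / E :=
  fun _ hx y hy => hx y (h hy)

open Classical in
/-- The `v`-operation `E^v = (E⁻¹)⁻¹` on nonzero `E`, where `E⁻¹ = (D : E) = {x ∈ K | xE ⊆ D}`,
which is `1 / E` in Mathlib's notation (`1` is the submodule `D` of `K`). -/
noncomputable def v : SemistarOperation D K where
  toFun E := if E = ⊥ then ⊥ else 1 / (1 / E)
  map_bot := by simp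
  map_smul x hx E hE := by
    have hxE : x • E ≠ ⊥ := by
      intro h
      apply hE
      rw [← inv_smul_smul₀ hx E, h, Submodule.smul_bot']
    rw [if_neg hE, if_neg hxE, one_div_smul hx, one_div_smul (inv_ne_zero hx), inv_inv]
  mono E F hE h := by
    have hF : F ≠ ⊥ := fun hF => hE (le_bot_iff.1 (hF ▸ h))
    rw [if_neg hE, if_neg hF]
    exact one_div_anti (one_div_anti h)
  le_apply E hE := by
    rw [if_neg hE]
    exact le_one_div_one_div E
  idem E hE := by
    have h : (1 : Submodule D K) / (1 / E) ≠ ⊥ := fun h =>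
      hE (le_bot_iff.1 (h ▸ le_one_div_one_div E))
    rw [if_neg hE, if_neg h]
    exact le_antisymm (one_div_anti (le_one_div_one_div _)) (le_one_div_one_div _)

/-- The `t`-operation `t = v_f`. -/
noncomputable def t : SemistarOperation D K := (v D K).finiteType

end

end SemistarOperation

section Multiplication

variable {D K : Type*} [CommRing D] [Field K] [Algebra D K]

/-- `E` is `⋆_f`-invertible: `(E E⁻¹)^{⋆_f} = D^⋆`. -/
def IsStarInvertible (s : SemistarOperation D K) (E : Submodule D K) : Prop :=
  s.finiteType (E * (1 / E)) = s 1

/-- Prüfer `⋆`-multiplication domain. -/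
def IsPStarMD (s : SemistarOperation D K) : Prop :=
  ∀ E : Submodule D K, E.FG → E ≠ ⊥ → IsStarInvertible s E

variable {ι : Type*}

/-- `I` is a homogeneous ideal, i.e. `I = I_h`, where `I_h` is the ideal generated by the
homogeneous elements of `I`. The family `𝒜` is the family of homogeneous components of `D`. -/
def IsHomogeneousIdeal (𝒜 : ι → AddSubgroup D) (I : Ideal D) : Prop :=
  I.homogeneousCore' 𝒜 = I

/-- Agreement with Mathlib's notion of homogeneous ideal for a graded ring. -/
theorem isHomogeneousIdeal_iff [DecidableEq ι] [AddMonoid ι] (𝒜 : ι → AddSubgroup D)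
    [GradedRing 𝒜] (I : Ideal D) : IsHomogeneousIdeal 𝒜 I ↔ I.IsHomogeneous 𝒜 :=
  (Ideal.IsHomogeneous.iff_eq 𝒜 I).symm

/-- Graded Prüfer `⋆`-multiplication domain: every nonzero finitely generated homogeneous ideal is
`⋆_f`-invertible. -/
def IsGradedPStarMD (𝒜 : ι → AddSubgroup D) (s : SemistarOperation D K) : Prop :=
  ∀ I : Ideal D, I.FG → I ≠ ⊥ → IsHomogeneousIdeal 𝒜 I →
    IsStarInvertible s (IsLocalization.coeSubmodule K I)

end Multiplication

/-- `D` (with quotient field `K`) is a Prüfer `v`-multiplication domain. -/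
def IsPvMD (D K : Type*) [CommRing D] [Field K] [Algebra D K] : Prop :=
  IsPStarMD (SemistarOperation.v D K)

/-- Graded Prüfer domain. -/
def IsGradedPrufer {D ι : Type*} (K : Type*) [CommRing D] [Field K] [Algebra D K]
    (𝒜 : ι → AddSubgroup D) : Prop :=
  IsGradedPStarMD 𝒜 (SemistarOperation.d D K)

section Overrings

variable {Γ R : Type*} [AddCommMonoid Γ] [CommRing R] (𝒜 : Γ → AddSubgroup R)

/-- The multiplicative set `H` of nonzero homogeneous elements of the graded domain `R`. -/
def nonzeroHomogeneous [SetLike.GradedMonoid 𝒜] : Submonoid R :=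
  SetLike.homogeneousSubmonoid 𝒜 ⊓ nonZeroDivisors R

variable [IsDomain R] (K : Type*) [Field K] [Algebra R K] [IsFractionRing R K]

/-- The homogeneous quotient field `R_H`, as a subalgebra of the quotient field `K`. -/
noncomputable def homogeneousQuotientField [SetLike.GradedMonoid 𝒜] : Subalgebra R K :=
  Localization.subalgebra.ofField K (nonzeroHomogeneous 𝒜) inf_le_right

/-- The homogeneous component `(R_H)_γ`, for `γ` in the quotient group `⟨Γ⟩` of `Γ`: zero and the
fractions `a / b` with `a ∈ R_α`, `0 ≠ b ∈ R_β` and `γ = α - β`. -/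
def homogeneousQuotientFieldComponent [IsCancelAdd Γ] [SetLike.GradedMonoid 𝒜]
    (γ : Algebra.GrothendieckAddGroup Γ) : AddSubgroup K where
  carrier := {x | x = 0 ∨ ∃ α β : Γ, ∃ a ∈ 𝒜 α, ∃ b ∈ 𝒜 β, b ≠ 0 ∧
    γ = Algebra.GrothendieckAddGroup.of α - Algebra.GrothendieckAddGroup.of β ∧
    x = algebraMap R K a / algebraMap R K b}
  zero_mem' := Or.inl rfl
  add_mem' := by
    rintro _ _ (rfl | ⟨α, β, a, ha, b, hb, hb0, hγ, rfl⟩) h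
    · simpa using h
    rcases h with rfl | ⟨α', β', a', ha', b', hb', hb0', hγ', rfl⟩
    · exact Or.inr ⟨α, β, a, ha, b, hb, hb0, hγ, by simp⟩
    have hdeg : α' + β = α + β' := by
      have h : Algebra.GrothendieckAddGroup.of (α' + β) =
          Algebra.GrothendieckAddGroup.of (α + β') := by
        have := hγ.symm.trans hγ'
        rw [sub_eq_sub_iff_add_eq_add] at this
        rw [map_add, map_add, this]
      obtain ⟨c, hc⟩ := (AddLocalization.addMonoidOf (⊤ : AddSubmonoid Γ)).eq_iff_exists.1 h
      exact add_left_cancel hc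
    have hK : ∀ {r : R}, r ≠ 0 → algebraMap R K r ≠ 0 := fun h =>
      (map_ne_zero_iff _ (IsFractionRing.injective R K)).2 h
    refine Or.inr ⟨α + β', β + β', a * b' + a' * b,
      add_mem (SetLike.mul_mem_graded ha hb') (hdeg ▸ SetLike.mul_mem_graded ha' hb),
      b * b', SetLike.mul_mem_graded hb hb', mul_ne_zero hb0 hb0', ?_, ?_⟩
    · rw [hγ, map_add, map_add]
      abel
    · have h1 := hK hb0
      have h2 := hK hb0'
      simp only [map_add, map_mul]
      field_simp
  neg_mem' := by
    rintro _ (rfl | ⟨α, β, a, ha, b, hb, hb0, hγ, rfl⟩)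
    · exact Or.inl neg_zero
    · exact Or.inr ⟨α, β, -a, neg_mem ha, b, hb, hb0, hγ, by simp [neg_div]⟩

variable {K} [IsCancelAdd Γ] [SetLike.GradedMonoid 𝒜]

/-- `T` is a homogeneous overring of `R`: `R ⊆ T ⊆ R_H` and every element of `T` is a sum of
elements of the groups `T ∩ (R_H)_γ` (the sum of these is direct since the sum of the `(R_H)_γ` is
direct). -/
structure IsHomogeneousOverring (T : Subalgebra R K) : Prop where
  le : T ≤ homogeneousQuotientField 𝒜 K
  eq_iSup : T.toSubring.toAddSubgroup =
    ⨆ γ, T.toSubring.toAddSubgroup ⊓ homogeneousQuotientFieldComponent 𝒜 K γ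

/-- The grading `T_γ = T ∩ (R_H)_γ` of a homogeneous overring `T`, as subgroups of `T`. -/
def overringComponent (T : Subalgebra R K) (γ : Algebra.GrothendieckAddGroup Γ) : AddSubgroup T :=
  (homogeneousQuotientFieldComponent 𝒜 K γ).comap (algebraMap T K).toAddMonoidHom

/-- `T` is a homogeneously `(⋆, ⋆')`-linked overring of `R`. -/
structure IsHomogeneouslyLinked (s : SemistarOperation R K) (T : Subalgebra R K)
    (s' : SemistarOperation T K) : Prop where
  isHomogeneousOverring : IsHomogeneousOverring 𝒜 T
  linked : ∀ F : Ideal R, F ≠ ⊥ → F.FG → IsHomogeneousIdeal 𝒜 F →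
    s (IsLocalization.coeSubmodule K F) = s 1 →
      s' (IsLocalization.coeSubmodule K (F.map (algebraMap R T))) = s' 1

end Overrings

/-! Everything is reduced to homogeneous elements. In a graded P⋆MD, if `E` is generated by finitely
many homogeneous fractions, not all zero, then `E E⁻¹` contains a finitely generated homogeneous
ideal `F` with `F^⋆ = R^⋆` (`IsGradedPStarMD.exists_ideal`). Linkedness makes `F T` trivial for `d`
or `t`, so `E T` is invertible or `t`-invertible.

The passage from homogeneous modules to all finitely generated ones is `IsGradedSubfield.isPvMD`.
Prüfer's identity leaves modules with two generators `f`, `g`. Finitely many elements of `R_H` live,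
up to homogeneous units and cosets of degrees, in a Laurent polynomial ring over a field, so `f` and
`g` may be taken coprime in `R_H`. If `x f` and `x g` lie in `T`, coprimality puts `x` in `R_H`, and
the Dedekind–Mertens lemma with `t`-invertible contents (a form of Gauss's lemma) shows that the
components of `x` multiply those of `f` and `g` into `T`. So `(f, g)` inherits `t`-invertibility
from the module generated by these components. P`v`MDs are integrally closed, and graded Prüfer
overrings satisfy the same criterion.

Conversely, let a homogeneous `E` fail to be `⋆_f`-invertible. Zorn's lemma gives a prime `Q ⊇ E
E⁻¹` with `1 ∉ Q^{⋆_f}`. Let `S` be the localization of `R` at the homogeneous elements outside `Q`.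
Homogeneous overrings containing `S` are `(⋆, d)`-linked, so `S` and `S[x²]` are integrally closed
for homogeneous `x`; hence `x ∈ S[x²]`, and a graded form of the classical `u, u⁻¹` argument gives
`x ∈ S` or `x⁻¹ ∈ S`. Then one generator of `E` divides the others in `S`, which produces an element
of `E E⁻¹` outside `Q`.

Elements of `R_H` are encoded in the group algebra of the degree group over `K`, the coefficient at
`γ` being the component of degree `γ`. -/

open AddMonoidAlgebra

/-! ### Orders on torsion-free groups -/

section Order

/-- A torsion-free abelian group can be linearly ordered. -/
theorem exists_linearOrder_isOrderedAddMonoid (G : Type*) [AddCommGroup G] [IsAddTorsionFree G] :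
    ∃ _ : LinearOrder G, IsOrderedAddMonoid G := by
  classical
  let b := Module.Basis.ofVectorSpace ℚ (DivisibleHull G)
  let _ : LinearOrder (Module.Basis.ofVectorSpaceIndex ℚ (DivisibleHull G)) :=
    linearOrderOfSTO WellOrderingRel
  -- The group embeds in a rational vector space; its order is the lexicographic order of the
  -- coordinates in a basis.
  let f : G → Lex (Module.Basis.ofVectorSpaceIndex ℚ (DivisibleHull G) →₀ ℚ) :=
    fun g => toLex (b.repr (g : DivisibleHull G))
  have hf : Function.Injective f := fun x y h =>
    DivisibleHull.coe_injective (b.repr.injective (toLex.injective h))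
  have hadd : ∀ x y, f (x + y) = f x + f y := fun x y => by
    simp only [f, DivisibleHull.coe_add, map_add, toLex_add]
  let _ : LinearOrder G := LinearOrder.lift' f hf
  refine ⟨inferInstance, ⟨fun x y h z => ?_, fun x y h z => ?_⟩⟩
  · change f (x + z) ≤ f (y + z)
    rw [hadd, hadd]
    have h : f x ≤ f y := h
    gcongr
  · change f (z + x) ≤ f (z + y)
    rw [hadd, hadd]
    have h : f x ≤ f y := h
    gcongr

end Order

/-! ### Contents and the Dedekind–Mertens lemma -/

namespace AddMonoidAlgebra

variable {G K : Type*} [Field K] (D : Type*) [CommRing D] [Algebra D K]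

/-- The content of an element of a group algebra: the submodule spanned by its coefficients. -/
def content (p : AddMonoidAlgebra K G) : Submodule D K := Submodule.span D (Set.range p.coeff)

variable {D}

theorem coeff_mem_content (p : AddMonoidAlgebra K G) (γ : G) : p.coeff γ ∈ content D p :=
  Submodule.subset_span ⟨γ, rfl⟩

theorem content_le {p : AddMonoidAlgebra K G} {E : Submodule D K} :
    content D p ≤ E ↔ ∀ γ, p.coeff γ ∈ E := by
  simp [content, Submodule.span_le, Set.range_subset_iff]

theorem content_single (γ : G) (x : K) :
    content D (single γ x) = Submodule.span D {x} := by
  refine le_antisymm (content_le.2 fun δ => ?_) ?_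
  · rw [coeff_single]
    by_cases h : γ = δ
    · subst h
      rw [Finsupp.single_eq_same]
      exact Submodule.mem_span_singleton_self x
    · rw [Finsupp.single_eq_of_ne' h]
      exact zero_mem _
  · rw [Submodule.span_singleton_le_iff_mem]
    simpa using coeff_mem_content (D := D) (single γ x) γ

theorem content_add_le (p q : AddMonoidAlgebra K G) :
    content D (p + q) ≤ content D p ⊔ content D q :=
  content_le.2 fun γ => Submodule.add_mem_sup (coeff_mem_content p γ) (coeff_mem_content q γ)

variable [AddCommGroup G]

theorem content_mul_le (p q : AddMonoidAlgebra K G) :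
    content D (p * q) ≤ content D p * content D q := by
  refine content_le.2 fun γ => ?_
  rw [coeff_mul_apply_left]
  exact sum_mem fun δ _ => Submodule.mul_mem_mul (coeff_mem_content p δ) (coeff_mem_content q _)

theorem content_mul_single (p : AddMonoidAlgebra K G) (γ : G) (x : K) :
    content D (p * single γ x) = content D p * Submodule.span D {x} := by
  refine le_antisymm ((content_mul_le _ _).trans_eq (by rw [content_single])) ?_
  rw [content, Submodule.span_mul_span, Submodule.span_le]
  rintro _ ⟨_, ⟨δ, rfl⟩, y, hy, rfl⟩
  rw [Set.mem_singleton_iff.1 hy]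
  have := coeff_mem_content (D := D) (p * single γ x) (δ + γ)
  rwa [coeff_mul_single_add] at this

/-- Dropping one term of `g` changes `f * g` by `f` times a monomial, whose content is explicit.
This drives the induction on the number of terms of `g`. -/
theorem content_mul_erase_le [DecidableEq G] (f g : AddMonoidAlgebra K G) (β : G) :
    content D (f * g.erase β) ≤
      content D (f * g) ⊔ content D f * Submodule.span D {g.coeff β} := by
  have h : f * g.erase β = f * g + f * single β (-g.coeff β) := by
    nth_rewrite 2 [← erase_add_single β g]
    rw [← mul_add, add_assoc, ← single_add]
    simp
  rw [h]
  refine (content_add_le _ _).trans (sup_le_sup le_rfl ?_)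
  rw [content_mul_single, ← Set.neg_singleton, Submodule.span_neg]

/-- The **Dedekind–Mertens lemma** for group algebras of torsion-free groups, with an explicit
exponent. -/
theorem content_pow_mul_content_le [IsAddTorsionFree G] (f : AddMonoidAlgebra K G) (m : ℕ) :
    ∀ g : AddMonoidAlgebra K G, g.coeff.support.card ≤ m + 1 →
      content D f ^ (m + 1) * content D g ≤ content D f ^ m * content D (f * g) := by
  classical
  obtain ⟨_, _⟩ := exists_linearOrder_isOrderedAddMonoid G
  set A := content D f with hA
  induction m with
  | zero =>
    intro g hg
    obtain ⟨β, hβ⟩ := Finsupp.card_support_le_one.1 (by simpa using hg)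
    have hg' : g = single β (g.coeff β) := coeff_injective hβ
    rw [hg', content_mul_single, content_single, pow_zero, one_mul, zero_add, pow_one]
  | succ m ih =>
    intro g hg
    rcases eq_or_ne g 0 with rfl | hg0
    · have : content D (0 : AddMonoidAlgebra K G) = ⊥ := by
        rw [eq_bot_iff, content_le]; simp
      simp [this]
    have hne : g.coeff.support.Nonempty := by simpa using hg0
    -- The induction removes the leading term of `g`.
    set β := g.coeff.support.max' hne with hβ
    have hβmem : β ∈ g.coeff.support := Finset.max'_mem _ _
    set b := g.coeff β with hb
    set X := A ^ (m + 1) * content D (f * g) with hX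
    have h1 : A ^ (m + 1) * content D (g.erase β) ≤
        A ^ m * content D (f * g) ⊔ Submodule.span D {b} * A ^ (m + 1) := by
      refine (ih (g.erase β) ?_).trans ?_
      · rw [coeff_erase, Finsupp.support_erase, Finset.card_erase_of_mem hβmem]
        omega
      · refine (mul_le_mul_right (content_mul_erase_le f g β) _).trans_eq ?_
        rw [Submodule.mul_sup, ← hA, pow_succ]
        congr 1
        rw [← mul_assoc, mul_comm]
    -- Descending induction on `α`, as a largest counterexample: solve the coefficient of `f * g` in
    -- degree `α + β` for `f_α b`.
    have claim : ∀ α, ∀ z ∈ A ^ (m + 1), f.coeff α * b * z ∈ X := by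
      by_contra! hcon
      let F := f.coeff.support.filter fun α => ∃ z ∈ A ^ (m + 1), f.coeff α * b * z ∉ X
      have hF : F.Nonempty := by
        obtain ⟨α, z, hz, hzX⟩ := hcon
        refine ⟨α, Finset.mem_filter.2 ⟨Finsupp.mem_support_iff.2 fun h => hzX ?_, z, hz, hzX⟩⟩
        simp [h]
      obtain ⟨hα, z, hz, hzX⟩ := Finset.mem_filter.1 (F.max'_mem hF)
      set α := F.max' hF
      have hbig : ∀ α', α < α' → ∀ z ∈ A ^ (m + 1), f.coeff α' * b * z ∈ X := by
        intro α' hα' z hz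
        by_contra hzX'
        have : α' ∈ F := Finset.mem_filter.2 ⟨Finsupp.mem_support_iff.2 fun h => hzX' (by simp [h]),
          z, hz, hzX'⟩
        exact absurd (F.le_max' _ this) (not_le.2 hα')
      apply hzX
      have hco : (f * g).coeff (α + β) =
          f.coeff α * b + ∑ α' ∈ f.coeff.support.erase α,
            f.coeff α' * g.coeff (-α' + (α + β)) := by
        rw [coeff_mul_apply_left, Finsupp.sum, ← Finset.add_sum_erase _ _ hα]
        simp [hb]
      have hz' : f.coeff α * b * z = z * (f * g).coeff (α + β) -
          ∑ α' ∈ f.coeff.support.erase α, f.coeff α' * (z * g.coeff (-α' + (α + β))) := by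
        have : ∑ α' ∈ f.coeff.support.erase α, f.coeff α' * (z * g.coeff (-α' + (α + β))) =
            z * ∑ α' ∈ f.coeff.support.erase α, f.coeff α' * g.coeff (-α' + (α + β)) := by
          rw [Finset.mul_sum]
          exact Finset.sum_congr rfl fun _ _ => by ring
        rw [this, hco]; ring
      rw [hz']
      refine sub_mem (Submodule.mul_mem_mul hz (coeff_mem_content _ _)) (sum_mem fun α' hα' => ?_)
      rcases lt_or_gt_of_ne (Finset.ne_of_mem_erase hα') with hlt | hgt
      · have h0 : g.coeff (-α' + (α + β)) = 0 := by
          by_contra hne0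
          have h := g.coeff.support.le_max' _ (Finsupp.mem_support_iff.2 hne0)
          rw [← hβ, neg_add_le_iff_le_add, add_comm α, add_comm α'] at h
          exact absurd (le_of_add_le_add_left h) (not_le.2 hlt)
        simp [h0]
      -- For `α' > α` the complementary degree is not `β`, so `h1` applies to the remaining part of
      -- `g`, and the maximality of `α` absorbs the terms containing `b`.
      · have hne' : β ≠ -α' + (α + β) := by
          intro h
          rw [eq_neg_add_iff_add_eq] at h
          exact hgt.ne' (add_right_cancel h)
        have hmem : z * g.coeff (-α' + (α + β)) ∈ A ^ (m + 1) * content D (g.erase β) := by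
          refine Submodule.mul_mem_mul hz ?_
          have := coeff_mem_content (D := D) (g.erase β) (-α' + (α + β))
          rwa [coeff_erase, Finsupp.erase_ne hne'.symm] at this
        obtain ⟨y, hy, w, hw, hyw⟩ := Submodule.mem_sup.1 (h1 hmem)
        rw [← hyw, mul_add]
        refine add_mem ?_ ?_
        · rw [hX, pow_succ', mul_assoc]
          exact Submodule.mul_mem_mul (coeff_mem_content f α') hy
        · obtain ⟨w', hw', rfl⟩ := Submodule.mem_span_singleton_mul.1 hw
          rw [← mul_assoc]
          exact hbig α' hgt w' hw'
    have h2 : Submodule.span D {b} * A ^ (m + 2) ≤ X := by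
      rw [pow_succ', ← mul_assoc, mul_comm (Submodule.span D {b})]
      refine Submodule.mul_le.2 fun y hy z hz => ?_
      rw [hA, content, Submodule.span_mul_span] at hy
      induction hy using Submodule.span_induction with
      | mem y hy =>
        obtain ⟨_, ⟨α, rfl⟩, _, rfl, rfl⟩ := hy
        exact claim α z hz
      | zero => simp
      | add y y' _ _ h h' => rw [add_mul]; exact add_mem h h'
      | smul c y _ h => rw [smul_mul_assoc]; exact Submodule.smul_mem _ c h
    have h3 : content D g ≤ content D (g.erase β) ⊔ Submodule.span D {b} := by
      nth_rewrite 1 [← erase_add_single β g]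
      exact (content_add_le _ _).trans_eq (by rw [content_single])
    refine (mul_le_mul_right h3 _).trans ?_
    rw [Submodule.mul_sup]
    refine sup_le ?_ ((mul_comm _ _).trans_le h2)
    rw [pow_succ', mul_assoc]
    refine (mul_le_mul_right h1 _).trans ?_
    rw [Submodule.mul_sup]
    refine sup_le ?_ ?_
    · rw [← mul_assoc, ← pow_succ']
    · rw [mul_left_comm, ← pow_succ']
      exact h2

end AddMonoidAlgebra

/-! ### Star-invertible and `t`-invertible modules -/

section StarInvertible

variable {D K : Type*} [CommRing D] [Field K] [Algebra D K]

theorem Submodule.mem_one_div {E : Submodule D K} {x : K} :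
    x ∈ (1 : Submodule D K) / E ↔ ∀ y ∈ E, x * y ∈ (1 : Submodule D K) :=
  Submodule.mem_div_iff_forall_mul_mem

theorem Submodule.mem_one_div_span {S : Set K} {x : K} :
    x ∈ (1 : Submodule D K) / Submodule.span D S ↔ ∀ y ∈ S, x * y ∈ (1 : Submodule D K) := by
  rw [Submodule.mem_one_div]
  refine ⟨fun h y hy => h y (Submodule.subset_span hy), fun h y hy => ?_⟩
  induction hy using Submodule.span_induction with
  | mem y hy => exact h y hy
  | zero => simp
  | add y y' _ _ h h' => rw [mul_add]; exact add_mem h h'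
  | smul c y _ h => rw [mul_smul_comm]; exact Submodule.smul_mem _ c h

theorem Submodule.mul_one_div_self_le (E : Submodule D K) : E * (1 / E) ≤ 1 :=
  Submodule.mul_le.2 fun x hx y hy => by rw [mul_comm]; exact Submodule.mem_one_div.1 hy x hx

theorem Submodule.mul_ne_bot_of_ne_bot {E F : Submodule D K} (hE : E ≠ ⊥) (hF : F ≠ ⊥) :
    E * F ≠ ⊥ := by
  obtain ⟨x, hx, hx0⟩ := Submodule.exists_mem_ne_zero_of_ne_bot hE
  obtain ⟨y, hy, hy0⟩ := Submodule.exists_mem_ne_zero_of_ne_bot hF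
  intro h
  have := Submodule.mul_mem_mul hx hy
  rw [h, Submodule.mem_bot] at this
  exact mul_ne_zero hx0 hy0 this

theorem Submodule.one_mem_one : (1 : K) ∈ (1 : Submodule D K) :=
  Submodule.one_le.1 le_rfl

/-- A finitely generated submodule of a product lies in a product with a finitely generated
second factor. -/
theorem Submodule.FG.exists_fg_le_mul {B E F : Submodule D K} (hB : B.FG) (h : B ≤ E * F) :
    ∃ F' : Submodule D K, F'.FG ∧ F' ≤ F ∧ B ≤ E * F' := by
  have key : ∀ x ∈ E * F, ∃ F' : Submodule D K, F'.FG ∧ F' ≤ F ∧ x ∈ E * F' := by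
    intro x hx
    induction hx using Submodule.mul_induction_on' with
    | mem_mul_mem m hm n hn =>
      exact ⟨Submodule.span D {n}, Submodule.fg_span_singleton n,
        (Submodule.span_singleton_le_iff_mem n F).2 hn,
        Submodule.mul_mem_mul hm (Submodule.mem_span_singleton_self n)⟩
    | add x _ y _ hx hy =>
      obtain ⟨F₁, h₁, h₁', h₁''⟩ := hx
      obtain ⟨F₂, h₂, h₂', h₂''⟩ := hy
      exact ⟨F₁ ⊔ F₂, h₁.sup h₂, sup_le h₁' h₂',
        add_mem (mul_le_mul' le_rfl (le_sup_left (b := F₂)) h₁'')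
          (mul_le_mul' le_rfl (le_sup_right (a := F₁)) h₂'')⟩
  obtain ⟨S, rfl⟩ := hB
  choose! φ hφ using fun x (hx : x ∈ S) => key x (h (Submodule.subset_span hx))
  refine ⟨⨆ x ∈ S, φ x, Submodule.fg_biSup S _ fun x hx => (hφ x hx).1,
    iSup₂_le fun x hx => (hφ x hx).2.1, Submodule.span_le.2 fun x hx => ?_⟩
  exact mul_le_mul' (le_refl E) (le_iSup₂_of_le (f := fun x _ => φ x) x hx le_rfl) (hφ x hx).2.2

namespace SemistarOperation

variable (s : SemistarOperation D K)

theorem finiteType_le (E : Submodule D K) : s.finiteType E ≤ s E := by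
  rintro x ⟨F, -, hF, hx⟩
  exact s.monotone hF hx

theorem finiteType_of_fg {E : Submodule D K} (hE : E.FG) : s.finiteType E = s E :=
  le_antisymm (s.finiteType_le E) fun _ hx => ⟨E, hE, le_rfl, hx⟩

theorem eq_apply_one_iff {E : Submodule D K} (hE : E ≤ 1) : s E = s 1 ↔ (1 : K) ∈ s E := by
  refine ⟨fun h => h ▸ s.le_self 1 Submodule.one_mem_one, fun h => ?_⟩
  refine le_antisymm (s.monotone hE) ?_
  rw [← s.apply_apply E]
  exact s.monotone (Submodule.one_le.2 h)

theorem mul_le_apply_mul (E F : Submodule D K) : s E * F ≤ s (E * F) := by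
  refine Submodule.mul_le.2 fun x hx y hy => ?_
  rcases eq_or_ne y 0 with rfl | hy0
  · simp
  have h : y • E ≤ E * F := by
    rintro _ ⟨e, he, rfl⟩
    rw [mul_comm E]
    exact Submodule.mul_mem_mul hy he
  have h' := s.monotone h
  rw [s.apply_smul hy0] at h'
  rw [mul_comm x]
  exact h' ⟨x, hx, rfl⟩

/-- Needed for the primeness of the modules found by Zorn's lemma: two comaximal-like modules have a
product of the same kind. -/
theorem one_mem_apply_mul {E F : Submodule D K} (hE : (1 : K) ∈ s E) (hF : (1 : K) ∈ s F) :
    (1 : K) ∈ s (E * F) := by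
  have h : F ≤ s (E * F) := fun y hy => by
    simpa using s.mul_le_apply_mul E F (Submodule.mul_mem_mul hE hy)
  have := s.monotone h hF
  rwa [s.apply_apply] at this

theorem v_apply_of_ne_bot {E : Submodule D K} (hE : E ≠ ⊥) : v D K E = 1 / (1 / E) :=
  if_neg hE

theorem one_mem_v_iff {E : Submodule D K} :
    (1 : K) ∈ v D K E ↔ E ≠ ⊥ ∧ (1 : Submodule D K) / E ≤ 1 := by
  rcases eq_or_ne E ⊥ with rfl | hE
  · simp [(v D K).map_bot]
  · rw [v_apply_of_ne_bot hE, Submodule.mem_one_div]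
    simp [hE, SetLike.le_def]

end SemistarOperation

open SemistarOperation

/-- Since `E E⁻¹ ⊆ D`, its closure is `D^⋆` as soon as it contains `1`, and `⋆_f` only sees finitely
generated submodules. -/
theorem isStarInvertible_iff {s : SemistarOperation D K} {E : Submodule D K} :
    IsStarInvertible s E ↔ ∃ B : Submodule D K, B.FG ∧ B ≤ E * (1 / E) ∧ (1 : K) ∈ s B := by
  rw [IsStarInvertible, ← s.finiteType_of_fg (E := 1) ?_,
    s.finiteType.eq_apply_one_iff (Submodule.mul_one_div_self_le E)]
  · rfl
  · rw [Submodule.one_eq_span]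
    exact Submodule.fg_span_singleton 1

/-- `t`-invertibility in terms of the elements of `E E⁻¹`: this product contains a nonzero finitely
generated module `B` with `B⁻¹ ⊆ D`. -/
def IsTInvertible (E : Submodule D K) : Prop :=
  ∃ B : Submodule D K, B.FG ∧ B ≠ ⊥ ∧ (1 : Submodule D K) / B ≤ 1 ∧ B ≤ E * (1 / E)

theorem isStarInvertible_v_iff {E : Submodule D K} :
    IsStarInvertible (v D K) E ↔ IsTInvertible E := by
  rw [isStarInvertible_iff]
  refine exists_congr fun B => ?_
  rw [one_mem_v_iff]
  tauto

namespace IsTInvertible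

theorem of_one_mem {E : Submodule D K} (h : (1 : K) ∈ E * (1 / E)) : IsTInvertible E := by
  refine ⟨1, ?_, ?_, ?_, Submodule.one_le.2 h⟩
  · rw [Submodule.one_eq_span]
    exact Submodule.fg_span_singleton 1
  · rw [Ne, Submodule.eq_bot_iff]
    exact fun h => one_ne_zero (h 1 Submodule.one_mem_one)
  · intro x hx
    simpa using Submodule.mem_one_div.1 hx 1 Submodule.one_mem_one

theorem span_singleton {x : K} (hx : x ≠ 0) : IsTInvertible (Submodule.span D {x}) := by
  refine of_one_mem ?_
  rw [← mul_inv_cancel₀ hx]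
  refine Submodule.mul_mem_mul (Submodule.mem_span_singleton_self x) ?_
  rw [Submodule.mem_one_div_span]
  rintro _ rfl
  rw [inv_mul_cancel₀ hx]
  exact Submodule.one_mem_one

theorem mul {E F : Submodule D K} (hE : IsTInvertible E) (hF : IsTInvertible F) :
    IsTInvertible (E * F) := by
  obtain ⟨B, hB, hB0, hB1, hBE⟩ := hE
  obtain ⟨C, hC, hC0, hC1, hCF⟩ := hF
  refine ⟨B * C, hB.mul hC, Submodule.mul_ne_bot_of_ne_bot hB0 hC0, fun x hx => ?_, ?_⟩
  · refine hB1 (Submodule.mem_one_div.2 fun b hb => hC1 (Submodule.mem_one_div.2 fun c hc => ?_))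
    rw [mul_assoc]
    exact Submodule.mem_one_div.1 hx _ (Submodule.mul_mem_mul hb hc)
  · refine (mul_le_mul' hBE hCF).trans ?_
    rw [mul_mul_mul_comm]
    refine mul_le_mul_right ?_ _
    rw [Submodule.le_div_iff_mul_le, mul_mul_mul_comm, mul_comm (1 / E), mul_comm (1 / F)]
    exact (mul_le_mul' (Submodule.mul_one_div_self_le E)
      (Submodule.mul_one_div_self_le F)).trans_eq (one_mul 1)

/-- The inverse of `E` contains `F (E F)⁻¹`, so the same `B` serves as a witness. -/
theorem of_mul {E F : Submodule D K} (h : IsTInvertible (E * F)) : IsTInvertible E := by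
  obtain ⟨B, hB, hB0, hB1, hBE⟩ := h
  refine ⟨B, hB, hB0, hB1, hBE.trans ?_⟩
  rw [mul_assoc]
  refine mul_le_mul_right ?_ _
  rw [Submodule.le_div_iff_mul_le, mul_comm, ← mul_assoc]
  exact Submodule.mul_one_div_self_le _

theorem one : IsTInvertible (1 : Submodule D K) := by
  rw [Submodule.one_eq_span]
  exact span_singleton one_ne_zero

theorem pow {E : Submodule D K} (hE : IsTInvertible E) (n : ℕ) : IsTInvertible (E ^ n) := by
  induction n with
  | zero => rw [pow_zero]; exact one
  | succ n ih => rw [pow_succ]; exact ih.mul hE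

/-- If `x E ⊆ E` for some `t`-invertible `E`, then `x ∈ D`. -/
theorem mem_one_of_mul_mem {E : Submodule D K} (hE : IsTInvertible E) {x : K}
    (hx : ∀ y ∈ E, x * y ∈ E) : x ∈ (1 : Submodule D K) := by
  obtain ⟨B, -, -, hB1, hBE⟩ := hE
  refine hB1 (Submodule.mem_one_div.2 fun b hb => ?_)
  -- Multiplication by `x` also preserves `E E⁻¹`, which lies in `D`; hence `x B ⊆ D`. No finite
  -- generation of `E` is needed.
  have : ∀ b ∈ E * (1 / E), x * b ∈ E * (1 / E) := by
    intro b hb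
    induction hb using Submodule.mul_induction_on' with
    | mem_mul_mem m hm n hn => rw [← mul_assoc]; exact Submodule.mul_mem_mul (hx m hm) hn
    | add y _ z _ hy hz => rw [mul_add]; exact add_mem hy hz
  exact Submodule.mul_one_div_self_le E (this b (hBE hb))

end IsTInvertible

/-- The classical identity that reduces invertibility of finitely generated modules to that of
modules with two generators. -/
theorem Submodule.sup_mul_sup_mul_sup (A B C : Submodule D K) :
    (A ⊔ B) * (B ⊔ C) * (C ⊔ A) = (A ⊔ B ⊔ C) * (A * B ⊔ B * C ⊔ C * A) := by
  simp only [← Submodule.add_eq_sup]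
  -- Both expansions agree up to the multiplicity of `ABC`, which is 2 on one side and 3 on the
  -- other; addition of submodules is idempotent.
  have h2 : A * B * C + A * B * C = A * B * C := by simp [Submodule.add_eq_sup]
  have e1 : (A + B) * (B + C) * (C + A) = A * A * B + A * A * C + A * B * B + B * B * C
      + B * C * C + A * C * C + (A * B * C + A * B * C) := by ring
  have e2 : (A + B + C) * (A * B + B * C + C * A) = A * A * B + A * A * C + A * B * B + B * B * C
      + B * C * C + A * C * C + (A * B * C + A * B * C + A * B * C) := by ring
  rw [e1, e2, h2, h2]

/-- Prüfer's argument: with generators `a`, `c` and a nonempty rest `T`, the identity exhibits the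
module as a factor of a product of the modules generated by `{a} ∪ T`, `{c} ∪ T` and `{c, a}`, all
with fewer generators. -/
theorem isTInvertible_span_of_pair
    (h : ∀ x y : K, x ≠ 0 → y ≠ 0 → IsTInvertible (Submodule.span D {x, y})) (n : ℕ) :
    ∀ S : Finset K, S.card = n + 1 → (0 : K) ∉ S → IsTInvertible (Submodule.span D (S : Set K)) := by
  classical
  induction n using Nat.strong_induction_on with
  | _ n ih =>
    intro S hS h0
    match n, ih, hS with
    | 0, _, hS =>
      obtain ⟨a, rfl⟩ := Finset.card_eq_one.1 hS
      rw [Finset.coe_singleton]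
      exact IsTInvertible.span_singleton fun h => h0 (by simp [h])
    | 1, _, hS =>
      obtain ⟨a, b, -, rfl⟩ := Finset.card_eq_two.1 hS
      rw [Finset.coe_pair]
      exact h a b (fun h => h0 (by simp [h])) (fun h => h0 (by simp [h]))
    | n + 2, ih, hS =>
      obtain ⟨a, S', ha, rfl, hS'⟩ := Finset.card_eq_succ.1 hS
      obtain ⟨c, T, hc, rfl, hT⟩ := Finset.card_eq_succ.1 hS'
      simp only [Finset.mem_insert, not_or] at ha h0
      have hA := ih (n + 1) (by omega) (insert a T) (by rw [Finset.card_insert_of_notMem ha.2, hT])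
        (by simp [h0.1, h0.2.2])
      have hC := ih (n + 1) (by omega) (insert c T) (by rw [Finset.card_insert_of_notMem hc, hT])
        (by simp [h0.2.1, h0.2.2])
      have hAC := h c a (Ne.symm h0.2.1) (Ne.symm h0.1)
      have key := (hA.mul hC).mul hAC
      simp only [Finset.coe_insert, Submodule.span_insert] at key ⊢
      rw [sup_comm (Submodule.span D {c}) (Submodule.span D (T : Set K)),
        Submodule.sup_mul_sup_mul_sup] at key
      have := key.of_mul
      rwa [sup_assoc, sup_comm (Submodule.span D (T : Set K))] at this

/-- A domain is a P`v`MD as soon as its modules with two generators are `t`-invertible. -/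
theorem isPvMD_of_pair
    (h : ∀ x y : K, x ≠ 0 → y ≠ 0 → IsTInvertible (Submodule.span D {x, y})) : IsPvMD D K := by
  classical
  rintro E ⟨S, rfl⟩ hE
  rw [isStarInvertible_v_iff, ← Submodule.span_sdiff_singleton_zero, ← Finset.coe_singleton,
    ← Finset.coe_sdiff]
  refine isTInvertible_span_of_pair h ((S \ {0}).card - 1) _ (Nat.sub_add_cancel ?_).symm (by simp)
  rw [Nat.one_le_iff_ne_zero, Ne, Finset.card_eq_zero]
  intro h0
  apply hE
  rw [← Submodule.span_sdiff_singleton_zero, ← Finset.coe_singleton,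
    ← Finset.coe_sdiff, h0]
  simp

/-- For `x` integral, `D[x]` is finitely generated, hence `t`-invertible, and is stable under `x`.
-/
theorem IsPvMD.isIntegrallyClosed [IsFractionRing D K] (h : IsPvMD D K) :
    IsIntegrallyClosed D := by
  rw [isIntegrallyClosed_iff K]
  intro x hx
  have hfg := hx.fg_adjoin_singleton
  have hne : Subalgebra.toSubmodule (Algebra.adjoin D {x}) ≠ ⊥ := by
    rw [Ne, Submodule.eq_bot_iff]
    exact fun h => one_ne_zero (h 1 (one_mem (Algebra.adjoin D {x})))
  have := (isStarInvertible_v_iff.1 (h _ hfg hne)).mem_one_of_mul_mem (x := x) fun y hy =>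
    (Algebra.adjoin D {x}).mul_mem (Algebra.self_mem_adjoin_singleton D x) hy
  simpa using this

end StarInvertible

/-! ### Graded fields inside a group algebra and their gcd property -/

section GradedSubfield

variable {G K : Type*} [AddCommGroup G] [Field K]

variable (G K) in
/-- The augmentation of a group algebra: the sum of the coefficients. -/
noncomputable def coeffSum : AddMonoidAlgebra K G →ₐ[K] K :=
  AddMonoidAlgebra.lift K K G 1

theorem coeffSum_single (γ : G) (x : K) : coeffSum G K (single γ x) = x := by
  simp [coeffSum]

theorem coeffSum_eq_sum (p : AddMonoidAlgebra K G) :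
    coeffSum G K p = ∑ γ ∈ p.coeff.support, p.coeff γ := by
  simp [coeffSum, AddMonoidAlgebra.lift_apply, Finsupp.sum]

theorem coeffSum_mem {S : Type*} [SetLike S K] [AddSubmonoidClass S K] {E : S}
    {p : AddMonoidAlgebra K G} (h : ∀ γ, p.coeff γ ∈ E) : coeffSum G K p ∈ E := by
  rw [coeffSum_eq_sum]
  exact sum_mem fun γ _ => h γ

/-- The family `C` of subgroups of the field `K` consists of the homogeneous components of a graded
field: its nonzero elements are closed under products and inverses, and its sum is direct.
An element of the sum is represented by the element of the group algebra having the homogeneous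
components as coefficients. -/
structure IsGradedSubfield (C : G → AddSubgroup K) : Prop where
  one_mem_zero : (1 : K) ∈ C 0
  mul_mem_add : ∀ {γ δ : G} {x y : K}, x ∈ C γ → y ∈ C δ → x * y ∈ C (γ + δ)
  inv_mem_neg : ∀ {γ : G} {x : K}, x ∈ C γ → x⁻¹ ∈ C (-γ)
  eq_zero : ∀ p : AddMonoidAlgebra K G, (∀ γ, p.coeff γ ∈ C γ) → coeffSum G K p = 0 → p = 0

namespace IsGradedSubfield

variable {C : G → AddSubgroup K}

/-- The subring of the group algebra that represents the graded field. -/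
def subring (hC : IsGradedSubfield C) : Subring (AddMonoidAlgebra K G) where
  carrier := {p | ∀ γ, p.coeff γ ∈ C γ}
  mul_mem' {p q} hp hq γ := by
    rw [coeff_mul_apply_left]
    refine sum_mem fun δ _ => ?_
    simpa using hC.mul_mem_add (hp δ) (hq (-δ + γ))
  one_mem' γ := by
    classical
    rw [one_def, coeff_single, Finsupp.single_apply]
    split_ifs with h
    · exact h ▸ hC.one_mem_zero
    · exact zero_mem _
  add_mem' hp hq γ := add_mem (hp γ) (hq γ)
  zero_mem' γ := zero_mem _
  neg_mem' hp γ := neg_mem (hp γ)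

theorem single_mem (hC : IsGradedSubfield C) {γ : G} {x : K} (hx : x ∈ C γ) :
    single γ x ∈ hC.subring := by
  classical
  intro δ
  rw [coeff_single, Finsupp.single_apply]
  split_ifs with h
  · exact h ▸ hx
  · exact zero_mem _

/-- Equalities in `K` between sums of homogeneous elements lift to the group algebra, where degrees
can be compared. -/
theorem coeffSum_injOn (hC : IsGradedSubfield C) {p q : AddMonoidAlgebra K G}
    (hp : p ∈ hC.subring) (hq : q ∈ hC.subring) (h : coeffSum G K p = coeffSum G K q) : p = q := by
  rw [← sub_eq_zero]
  exact hC.eq_zero _ (sub_mem hp hq) (by rw [map_sub, h, sub_self])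

/-- The field of elements of degree zero. -/
def degreeZero (hC : IsGradedSubfield C) : Subfield K where
  carrier := C 0
  mul_mem' hx hy := by simpa using hC.mul_mem_add hx hy
  one_mem' := hC.one_mem_zero
  add_mem' hx hy := add_mem hx hy
  zero_mem' := zero_mem _
  neg_mem' hx := neg_mem hx
  inv_mem' x hx := by simpa using hC.inv_mem_neg hx

/-- The degrees of nonzero homogeneous elements. -/
def degrees (hC : IsGradedSubfield C) : AddSubgroup G where
  carrier := {γ | ∃ x ∈ C γ, x ≠ 0}
  zero_mem' := ⟨1, hC.one_mem_zero, one_ne_zero⟩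
  add_mem' := by
    rintro γ δ ⟨x, hx, hx0⟩ ⟨y, hy, hy0⟩
    exact ⟨x * y, hC.mul_mem_add hx hy, mul_ne_zero hx0 hy0⟩
  neg_mem' := by
    rintro γ ⟨x, hx, hx0⟩
    exact ⟨x⁻¹, hC.inv_mem_neg hx, inv_ne_zero hx0⟩

variable {ι : Type*}

/-- The ring homomorphism from a polynomial ring over the field of elements of degree zero that
sends the variables to given monomials. -/
noncomputable def ofMvPolynomial (hC : IsGradedSubfield C) (e : ι → G) (u : ι → K) :
    MvPolynomial ι hC.degreeZero →+* AddMonoidAlgebra K G :=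
  MvPolynomial.eval₂Hom (singleZeroRingHom.comp hC.degreeZero.subtype) fun i => single (e i) (u i)

theorem ofMvPolynomial_monomial (hC : IsGradedSubfield C) (e : ι → G) (u : ι → K) (m : ι →₀ ℕ)
    (c : hC.degreeZero) :
    hC.ofMvPolynomial e u (MvPolynomial.monomial m c) =
      single (Finsupp.linearCombination ℕ e m) (c * m.prod fun i n => u i ^ n) := by
  rw [ofMvPolynomial, MvPolynomial.eval₂Hom_monomial]
  simp only [Finsupp.prod, single_pow, AddMonoidAlgebra.prod_single]
  simp [singleZeroRingHom, single_mul_single, Finsupp.linearCombination_apply, Finsupp.sum]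

theorem prod_pow_mem (hC : IsGradedSubfield C) {e : ι → G} {u : ι → K} (hu : ∀ i, u i ∈ C (e i))
    (m : ι →₀ ℕ) : (m.prod fun i n => u i ^ n) ∈ C (Finsupp.linearCombination ℕ e m) := by
  have h : ∏ i ∈ m.support, single (e i) (u i) ^ m i ∈ hC.subring :=
    prod_mem fun i _ => pow_mem (hC.single_mem (hu i)) _
  simp only [single_pow, AddMonoidAlgebra.prod_single] at h
  have := h (∑ i ∈ m.support, m i • e i)
  rw [coeff_single, Finsupp.single_eq_same] at this
  simpa [Finsupp.linearCombination_apply, Finsupp.sum, Finsupp.prod] using this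

theorem prod_pow_ne_zero {u : ι → K} (hu0 : ∀ i, u i ≠ 0) (m : ι →₀ ℕ) :
    (m.prod fun i n => u i ^ n) ≠ 0 :=
  Finset.prod_ne_zero_iff.2 fun i _ => pow_ne_zero _ (hu0 i)

theorem ofMvPolynomial_mem (hC : IsGradedSubfield C) {e : ι → G} {u : ι → K}
    (hu : ∀ i, u i ∈ C (e i)) (P : MvPolynomial ι hC.degreeZero) :
    hC.ofMvPolynomial e u P ∈ hC.subring := by
  rw [P.as_sum, map_sum]
  refine sum_mem fun m _ => ?_
  rw [ofMvPolynomial_monomial]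
  refine hC.single_mem ?_
  simpa using hC.mul_mem_add (P.coeff m).2 (hC.prod_pow_mem hu m)

/-- Independence of the degrees `e` gives different monomials different degrees, so nothing cancels.
-/
theorem ofMvPolynomial_coeff_linearCombination (hC : IsGradedSubfield C) {e : ι → G} {u : ι → K}
    (he : LinearIndependent ℕ e) (P : MvPolynomial ι hC.degreeZero) (m : ι →₀ ℕ) :
    (hC.ofMvPolynomial e u P).coeff (Finsupp.linearCombination ℕ e m) =
      P.coeff m * m.prod fun i n => u i ^ n := by
  classical
  nth_rewrite 1 [P.as_sum]
  rw [map_sum, coeff_sum, Finsupp.finsetSum_apply, Finset.sum_eq_single m]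
  · rw [ofMvPolynomial_monomial, coeff_single, Finsupp.single_eq_same]
  · intro m' _ hm'
    rw [ofMvPolynomial_monomial, coeff_single, Finsupp.single_eq_of_ne]
    exact fun h => hm' (he h).symm
  · intro hm
    rw [MvPolynomial.notMem_support_iff.1 hm]
    simp

theorem ofMvPolynomial_injective (hC : IsGradedSubfield C) {e : ι → G} {u : ι → K}
    (he : LinearIndependent ℕ e) (hu0 : ∀ i, u i ≠ 0) :
    Function.Injective (hC.ofMvPolynomial e u) := by
  refine (injective_iff_map_eq_zero _).2 fun P hP => ?_
  ext m
  have := hC.ofMvPolynomial_coeff_linearCombination (u := u) he P m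
  rw [hP] at this
  simpa [prod_pow_ne_zero hu0] using this.symm

theorem ofMvPolynomial_coeff_eq_zero (hC : IsGradedSubfield C) {e : ι → G} {u : ι → K}
    (P : MvPolynomial ι hC.degreeZero) {γ : G} (hγ : γ ∉ AddSubgroup.closure (Set.range e)) :
    (hC.ofMvPolynomial e u P).coeff γ = 0 := by
  rw [P.as_sum, map_sum, coeff_sum, Finsupp.finsetSum_apply]
  refine Finset.sum_eq_zero fun m _ => ?_
  rw [ofMvPolynomial_monomial, coeff_single, Finsupp.single_eq_of_ne]
  rintro rfl
  refine hγ ?_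
  rw [Finsupp.linearCombination_apply]
  exact sum_mem fun i _ => nsmul_mem (AddSubgroup.subset_closure (Set.mem_range_self i)) _

theorem exists_add_linearCombination {e : ι → G} {γ : G}
    (hγ : γ ∈ AddSubgroup.closure (Set.range e)) :
    ∃ m m' : ι →₀ ℕ, γ + Finsupp.linearCombination ℕ e m = Finsupp.linearCombination ℕ e m' := by
  induction hγ using AddSubgroup.closure_induction with
  | mem x hx =>
    obtain ⟨i, rfl⟩ := hx
    exact ⟨0, Finsupp.single i 1, by simp⟩
  | zero => exact ⟨0, 0, by simp⟩
  | add x y _ _ hx hy =>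
    obtain ⟨m, m', h⟩ := hx
    obtain ⟨n, n', h'⟩ := hy
    exact ⟨m + n, m' + n', by rw [map_add, map_add, ← h, ← h']; abel⟩
  | neg x _ hx =>
    obtain ⟨m, m', h⟩ := hx
    exact ⟨m', m, by rw [← h]; abel⟩

/-- Up to a monomial, homogeneous sums with degrees in the group generated by `e` are
polynomials. -/
theorem exists_mul_eq_ofMvPolynomial (hC : IsGradedSubfield C) {e : ι → G} {u : ι → K}
    (hu : ∀ i, u i ∈ C (e i)) (hu0 : ∀ i, u i ≠ 0) {a : AddMonoidAlgebra K G}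
    (ha : a ∈ hC.subring) (hsupp : ∀ γ ∉ AddSubgroup.closure (Set.range e), a.coeff γ = 0) :
    ∃ (m : ι →₀ ℕ) (P : MvPolynomial ι hC.degreeZero),
      a * hC.ofMvPolynomial e u (MvPolynomial.monomial m 1) = hC.ofMvPolynomial e u P := by
  rw [← a.sum_coeff_single, Finsupp.sum]
  refine Finset.sum_induction _ (fun b : AddMonoidAlgebra K G => ∃ (m : ι →₀ ℕ)
    (P : MvPolynomial ι hC.degreeZero),
      b * hC.ofMvPolynomial e u (MvPolynomial.monomial m 1) = hC.ofMvPolynomial e u P) ?_ ?_ ?_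
  · rintro b c ⟨m, P, h⟩ ⟨n, Q, h'⟩
    refine ⟨m + n, P * MvPolynomial.monomial n 1 + Q * MvPolynomial.monomial m 1, ?_⟩
    have : (MvPolynomial.monomial (m + n) 1 : MvPolynomial ι hC.degreeZero) =
      MvPolynomial.monomial m 1 * MvPolynomial.monomial n 1 := by simp [MvPolynomial.monomial_mul]
    rw [this, map_add, map_mul, map_mul, map_mul, ← h, ← h']
    ring
  · exact ⟨0, 0, by simp⟩
  · intro γ hγ
    obtain ⟨m, m', h⟩ := exists_add_linearCombination (e := e) (γ := γ)
      (by_contra fun h => Finsupp.mem_support_iff.1 hγ (hsupp γ h))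
    have hc : a.coeff γ * (m.prod fun i n => u i ^ n) * (m'.prod fun i n => u i ^ n)⁻¹ ∈ C 0 := by
      have := hC.mul_mem_add (hC.mul_mem_add (ha γ) (hC.prod_pow_mem hu m))
        (hC.inv_mem_neg (hC.prod_pow_mem hu m'))
      rwa [h, add_neg_cancel] at this
    refine ⟨m, MvPolynomial.monomial m' ⟨_, hc⟩, ?_⟩
    rw [ofMvPolynomial_monomial, ofMvPolynomial_monomial, single_mul_single, h]
    simp [prod_pow_ne_zero hu0]

end IsGradedSubfield

namespace AddMonoidAlgebra

open Classical in
/-- The part of an element of a group algebra with degrees in the coset `γ₀ + N`. -/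
noncomputable def cosetPart (N : AddSubgroup G) (γ₀ : G) (a : AddMonoidAlgebra K G) :
    AddMonoidAlgebra K G :=
  ofCoeff (a.coeff.filter fun γ => γ - γ₀ ∈ N)

open Classical in
theorem coeff_cosetPart (N : AddSubgroup G) (γ₀ : G) (a : AddMonoidAlgebra K G) (γ : G) :
    (cosetPart N γ₀ a).coeff γ = if γ - γ₀ ∈ N then a.coeff γ else 0 :=
  Finsupp.filter_apply ..

/-- Multiplication by an element with degrees in `N` preserves each coset of `N`. -/
theorem cosetPart_mul (N : AddSubgroup G) (γ₀ : G) (a : AddMonoidAlgebra K G)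
    {s : AddMonoidAlgebra K G} (hs : ∀ γ ∉ N, s.coeff γ = 0) :
    cosetPart N γ₀ (a * s) = cosetPart N γ₀ a * s := by
  ext γ
  rw [coeff_cosetPart, coeff_mul_apply_right, coeff_mul_apply_right, Finsupp.sum, Finsupp.sum]
  split_ifs with h
  · refine Finset.sum_congr rfl fun δ hδ => ?_
    have hδN : δ ∈ N := by_contra fun h => Finsupp.mem_support_iff.1 hδ (hs δ h)
    rw [coeff_cosetPart, if_pos]
    have := sub_mem h hδN
    rwa [sub_right_comm, sub_eq_add_neg γ] at this
  · refine (Finset.sum_eq_zero fun δ hδ => ?_).symm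
    have hδN : δ ∈ N := by_contra fun h => Finsupp.mem_support_iff.1 hδ (hs δ h)
    rw [coeff_cosetPart, if_neg, zero_mul]
    intro h'
    have := add_mem h' hδN
    apply h
    convert this using 1
    abel

end AddMonoidAlgebra

namespace IsGradedSubfield

variable {C : G → AddSubgroup K} {ι : Type*}

theorem cosetPart_mem (hC : IsGradedSubfield C) (N : AddSubgroup G) (γ₀ : G)
    {a : AddMonoidAlgebra K G} (ha : a ∈ hC.subring) : cosetPart N γ₀ a ∈ hC.subring := by
  intro γ
  rw [coeff_cosetPart]
  split_ifs
  · exact ha γ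
  · exact zero_mem _

theorem single_mul_single_inv (γ : G) {x : K} (hx : x ≠ 0) :
    single γ x * single (-γ) x⁻¹ = (1 : AddMonoidAlgebra K G) := by
  rw [single_mul_single, add_neg_cancel, mul_inv_cancel₀ hx, one_def]

/-- Monomials are invertible in the subring of the graded field. -/
theorem exists_ofMvPolynomial_monomial_mul_eq_one (hC : IsGradedSubfield C) {e : ι → G} {u : ι → K}
    (hu : ∀ i, u i ∈ C (e i)) (hu0 : ∀ i, u i ≠ 0) (m : ι →₀ ℕ) :
    ∃ z ∈ hC.subring, hC.ofMvPolynomial e u (MvPolynomial.monomial m 1) * z = 1 := by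
  rw [ofMvPolynomial_monomial]
  refine ⟨_, ?_, single_mul_single_inv _ ?_⟩
  · refine hC.single_mem (hC.inv_mem_neg ?_)
    simpa using hC.prod_pow_mem hu m
  · simpa using prod_pow_ne_zero hu0 m

/-- Relatively prime polynomials stay coprime in the graded field: the degrees of the cofactors are
sorted by their classes modulo the group of degrees of the polynomials. -/
theorem exists_eq_mul_ofMvPolynomial (hC : IsGradedSubfield C) {e : ι → G} {u : ι → K}
    (he : LinearIndependent ℕ e) (hu : ∀ i, u i ∈ C (e i)) (hu0 : ∀ i, u i ≠ 0)
    {P Q : MvPolynomial ι hC.degreeZero} (hPQ : IsRelPrime P Q) (n : ℕ) :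
    ∀ a ∈ hC.subring, ∀ b ∈ hC.subring, a.coeff.support.card ≤ n →
      a * hC.ofMvPolynomial e u Q = b * hC.ofMvPolynomial e u P →
        ∃ c ∈ hC.subring, a = c * hC.ofMvPolynomial e u P := by
  classical
  set ψ := hC.ofMvPolynomial e u with hψ
  set N := AddSubgroup.closure (Set.range e)
  induction n with
  | zero =>
    intro a _ b _ hcard _
    have : a = 0 := by simpa using hcard
    exact ⟨0, zero_mem _, by simp [this]⟩
  | succ n ih =>
    intro a ha b hb hcard hab
    rcases eq_or_ne a 0 with rfl | ha0
    · exact ⟨0, zero_mem _, by simp⟩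
    obtain ⟨γ₀, hγ₀⟩ : a.coeff.support.Nonempty := by simpa using ha0
    set w := a.coeff γ₀ with hw
    have hw0 : w ≠ 0 := Finsupp.mem_support_iff.1 hγ₀
    have hsupp : ∀ R : MvPolynomial ι hC.degreeZero, ∀ γ ∉ N, (ψ R).coeff γ = 0 :=
      fun R γ hγ => hC.ofMvPolynomial_coeff_eq_zero R hγ
    have habc : cosetPart N γ₀ a * ψ Q = cosetPart N γ₀ b * ψ P := by
      rw [← cosetPart_mul N γ₀ a (hsupp Q), ← cosetPart_mul N γ₀ b (hsupp P), hab]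
    -- Dividing by the monomial `w` of degree `γ₀` moves the coset `γ₀ + N` to `N`, where elements
    -- are Laurent polynomials; a further monomial clears the negative exponents.
    have hshift : ∀ x ∈ hC.subring, ∃ (m : ι →₀ ℕ) (X : MvPolynomial ι hC.degreeZero),
        cosetPart N γ₀ x * single (-γ₀) w⁻¹ * ψ (MvPolynomial.monomial m 1) = ψ X := by
      intro x hx
      refine hC.exists_mul_eq_ofMvPolynomial hu hu0
        (mul_mem (hC.cosetPart_mem N γ₀ hx) (hC.single_mem (hC.inv_mem_neg (ha γ₀)))) ?_
      intro γ hγ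
      rw [coeff_mul_single_apply, coeff_cosetPart, if_neg, zero_mul]
      simpa using hγ
    obtain ⟨m, A, hA⟩ := hshift a ha
    obtain ⟨m', B, hB⟩ := hshift b hb
    -- The relation now holds between polynomials, where `P` is relatively prime to `Q`; the
    -- monomials are units in the graded field and are removed afterwards.
    have hdvd : P ∣ A * MvPolynomial.monomial m' 1 := by
      refine hPQ.dvd_of_dvd_mul_right ⟨B * MvPolynomial.monomial m 1, ?_⟩
      apply hC.ofMvPolynomial_injective he hu0
      rw [← hψ]
      simp only [map_mul]
      rw [← hA, ← hB]
      linear_combination single (-γ₀) w⁻¹ * ψ (MvPolynomial.monomial m 1) *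
        ψ (MvPolynomial.monomial m' 1) * habc
    obtain ⟨X, hX⟩ := hdvd
    obtain ⟨z, hz, hz1⟩ := hC.exists_ofMvPolynomial_monomial_mul_eq_one hu hu0 m
    obtain ⟨z', hz', hz1'⟩ := hC.exists_ofMvPolynomial_monomial_mul_eq_one hu hu0 m'
    have hs1 := single_mul_single_inv γ₀ hw0
    have hc1 : cosetPart N γ₀ a = ψ X * z * z' * single γ₀ w * ψ P := by
      have h : ψ A * ψ (MvPolynomial.monomial m' 1) = ψ P * ψ X := by
        rw [← map_mul, hX, map_mul]
      rw [← hA] at h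
      calc cosetPart N γ₀ a = cosetPart N γ₀ a * (single γ₀ w * single (-γ₀) w⁻¹) *
            (ψ (MvPolynomial.monomial m 1) * z) * (ψ (MvPolynomial.monomial m' 1) * z') := by
            rw [hs1, hz1, hz1']; ring
        _ = _ := by linear_combination single γ₀ w * z * z' * h
    -- Removing the whole coset of `γ₀` removes at least the term in degree `γ₀`.
    have hcard' : (a - cosetPart N γ₀ a).coeff.support.card ≤ n := by
      have hsub : (a - cosetPart N γ₀ a).coeff.support ⊆ a.coeff.support.erase γ₀ := by
        intro γ hγ
        have hγ' : a.coeff γ - (cosetPart N γ₀ a).coeff γ ≠ 0 := Finsupp.mem_support_iff.1 hγ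
        rw [coeff_cosetPart] at hγ'
        refine Finset.mem_erase.2 ⟨?_, Finsupp.mem_support_iff.2 fun h => ?_⟩
        · rintro rfl
          simp at hγ'
        · simp [h] at hγ'
      have := Finset.card_le_card hsub
      rw [Finset.card_erase_of_mem hγ₀] at this
      omega
    obtain ⟨c, hc, hac⟩ := ih (a - cosetPart N γ₀ a) (sub_mem ha (hC.cosetPart_mem N γ₀ ha))
      (b - cosetPart N γ₀ b) (sub_mem hb (hC.cosetPart_mem N γ₀ hb)) hcard'
      (by rw [sub_mul, sub_mul, hab, habc])
    refine ⟨c + ψ X * z * z' * single γ₀ w, add_mem hc (mul_mem (mul_mem (mul_mem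
      (hC.ofMvPolynomial_mem hu X) hz) hz') (hC.single_mem (ha γ₀))), ?_⟩
    rw [add_mul, ← hac, ← hc1, sub_add_cancel]

/-- A graded field is a GCD domain, in the form that two nonzero elements can be divided by a common
factor so that the quotients are coprime. -/
theorem exists_coprime_factors [IsAddTorsionFree G] (hC : IsGradedSubfield C)
    {p q : AddMonoidAlgebra K G} (hp : p ∈ hC.subring) (hq : q ∈ hC.subring) (hp0 : p ≠ 0) :
    ∃ d ∈ hC.subring, ∃ p' ∈ hC.subring, ∃ q' ∈ hC.subring, p = d * p' ∧ q = d * q' ∧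
      ∀ a ∈ hC.subring, ∀ b ∈ hC.subring, a * q' = b * p' → ∃ c ∈ hC.subring, a = c * p' := by
  classical
  let S : Finset G := p.coeff.support ∪ q.coeff.support
  let N : Submodule ℤ G := Submodule.span ℤ (S : Set G)
  have : Module.Finite ℤ N := Module.Finite.span_finset ℤ S
  -- The degrees of `p` and `q` generate a finitely generated torsion-free group, which is free.
  let B := Module.Free.chooseBasis ℤ N
  let e : Module.Free.ChooseBasisIndex ℤ N → G := fun i => B i
  have he : LinearIndependent ℕ e := by
    have h : LinearIndependent ℤ e :=
      B.linearIndependent.map' N.subtype (Submodule.ker_subtype N)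
    refine h.restrict_scalars (R := ℕ) fun m n hmn => ?_
    simpa using hmn
  have hN : ∀ γ ∈ N, γ ∈ AddSubgroup.closure (Set.range e) := by
    intro γ hγ
    have h := B.sum_repr ⟨γ, hγ⟩
    have h' := congrArg N.subtype h
    rw [map_sum] at h'
    rw [show γ = N.subtype ⟨γ, hγ⟩ from rfl, ← h']
    refine sum_mem fun i _ => ?_
    rw [map_smul]
    exact zsmul_mem (AddSubgroup.subset_closure (Set.mem_range_self i)) _
  have hdeg : ∀ γ ∈ N, γ ∈ hC.degrees := by
    intro γ hγ
    refine (Submodule.span_le (p := hC.degrees.toIntSubmodule)).2 ?_ hγ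
    intro δ hδ
    rcases Finset.mem_union.1 hδ with h | h
    · exact ⟨_, hp δ, Finsupp.mem_support_iff.1 h⟩
    · exact ⟨_, hq δ, Finsupp.mem_support_iff.1 h⟩
  -- Each basis degree is an integer combination of degrees of nonzero components, hence itself the
  -- degree of a nonzero homogeneous element.
  choose u hu hu0 using fun i => hdeg (e i) (B i).2
  set ψ := hC.ofMvPolynomial e u with hψ
  have hsupp : ∀ x : AddMonoidAlgebra K G, x.coeff.support ⊆ S →
      ∀ γ ∉ AddSubgroup.closure (Set.range e), x.coeff γ = 0 := by
    intro x hx γ hγ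
    by_contra h
    exact hγ (hN γ (Submodule.subset_span (hx (Finsupp.mem_support_iff.2 h))))
  obtain ⟨m, P, hP⟩ := hC.exists_mul_eq_ofMvPolynomial hu hu0 hp
    (hsupp p Finset.subset_union_left)
  obtain ⟨n, Q, hQ⟩ := hC.exists_mul_eq_ofMvPolynomial hu hu0 hq
    (hsupp q Finset.subset_union_right)
  rw [← hψ] at hP hQ
  obtain ⟨z, hz, hz1⟩ := hC.exists_ofMvPolynomial_monomial_mul_eq_one hu hu0 m
  obtain ⟨y, hy, hy1⟩ := hC.exists_ofMvPolynomial_monomial_mul_eq_one hu hu0 n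
  have hP0 : P ≠ 0 := by
    rintro rfl
    apply hp0
    rw [map_zero] at hP
    calc p = p * ψ (MvPolynomial.monomial m 1) * z := by rw [mul_assoc, hz1, mul_one]
      _ = 0 := by rw [hP, zero_mul]
  -- Up to monomial units, `p` and `q` are polynomials in finitely many variables over a field, and
  -- a gcd can be taken out.
  obtain ⟨P', Q', c, hrel, rfl, rfl⟩ := UniqueFactorizationMonoid.exists_reduced_factors P hP0 Q
  rw [map_mul] at hP hQ
  refine ⟨ψ c, hC.ofMvPolynomial_mem hu c, ψ P' * z, mul_mem (hC.ofMvPolynomial_mem hu P') hz,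
    ψ Q' * y, mul_mem (hC.ofMvPolynomial_mem hu Q') hy, ?_, ?_, fun a ha b hb hab => ?_⟩
  · linear_combination z * hP - p * hz1
  · linear_combination y * hQ - q * hy1
  · obtain ⟨w, hw, haw⟩ := hC.exists_eq_mul_ofMvPolynomial he hu hu0 hrel _ (a * y)
      (mul_mem ha hy) (b * z) (mul_mem hb hz) le_rfl
      (by rw [← hψ]; linear_combination hab)
    rw [← hψ] at haw
    refine ⟨w * ψ (MvPolynomial.monomial n 1) * ψ (MvPolynomial.monomial m 1),
      mul_mem (mul_mem hw (hC.ofMvPolynomial_mem hu _)) (hC.ofMvPolynomial_mem hu _), ?_⟩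
    linear_combination ψ (MvPolynomial.monomial n 1) * haw - a * hy1 -
      w * ψ P' * ψ (MvPolynomial.monomial n 1) * hz1

end IsGradedSubfield

end GradedSubfield

/-! ### From homogeneous `t`-invertibility to P`v`MDs -/

section GradedPvMD

variable {G K D : Type*} [AddCommGroup G] [Field K] [CommRing D] [Algebra D K]

/-- Every element of `E` is a sum of elements of `E` that are homogeneous with respect to `C`. -/
def HasHomogeneousComponents (C : G → AddSubgroup K) (E : Submodule D K) : Prop :=
  ∀ x ∈ E, ∃ p : AddMonoidAlgebra K G,
    (∀ γ, p.coeff γ ∈ C γ) ∧ (∀ γ, p.coeff γ ∈ E) ∧ coeffSum G K p = x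

variable {C : G → AddSubgroup K}

theorem HasHomogeneousComponents.coeff_mem {E : Submodule D K} (hE : HasHomogeneousComponents C E)
    (hC : IsGradedSubfield C) {p : AddMonoidAlgebra K G} (hp : p ∈ hC.subring)
    (h : coeffSum G K p ∈ E) (γ : G) : p.coeff γ ∈ E := by
  obtain ⟨q, hq, hqE, hqp⟩ := hE _ h
  rw [← hC.coeffSum_injOn hq hp hqp]
  exact hqE γ

namespace IsGradedSubfield

/-- If all modules generated by finitely many homogeneous elements are `t`-invertible and the
coefficients of `z p` are in `D`, then so are the products of a coefficient of `z` and one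
of `p`. -/
theorem coeff_mul_coeff_mem_one [IsAddTorsionFree G] (hC : IsGradedSubfield C)
    (hinv : ∀ S : Finset K, (∀ x ∈ S, ∃ γ, x ∈ C γ) → (∃ x ∈ S, x ≠ 0) →
      IsTInvertible (Submodule.span D (S : Set K)))
    {z p : AddMonoidAlgebra K G} (hp : p ∈ hC.subring) (hp0 : p ≠ 0)
    (h : ∀ γ, (z * p).coeff γ ∈ (1 : Submodule D K)) (γ δ : G) :
    z.coeff γ * p.coeff δ ∈ (1 : Submodule D K) := by
  have hinvp : IsTInvertible (content D p) := by
    have := hinv p.coeff.finite_range.toFinset (by simpa using fun γ => ⟨γ, hp γ⟩) (by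
      by_contra! hcon
      exact hp0 (coeff_injective (Finsupp.ext fun γ => hcon (p.coeff γ) (by simp))))
    rwa [Set.Finite.coe_toFinset] at this
  set m := z.coeff.support.card
  have hDM := content_pow_mul_content_le (D := D) p m z (Nat.le_succ _)
  rw [mul_comm p z] at hDM
  -- Dedekind–Mertens gives `c(p)^(m+1) c(z) ⊆ c(p)^m c(zp) ⊆ c(p)^m`, so the product of
  -- coefficients stabilizes a `t`-invertible module.
  refine (hinvp.pow m).mem_one_of_mul_mem fun y hy => ?_
  have h1 : content D p ^ m * content D (z * p) ≤ content D p ^ m := by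
    refine (mul_le_mul' le_rfl (content_le.2 h)).trans_eq (mul_one _)
  refine h1 (hDM ?_)
  rw [mul_comm (z.coeff γ), mul_right_comm, pow_succ']
  exact Submodule.mul_mem_mul (Submodule.mul_mem_mul (coeff_mem_content p δ) hy)
    (coeff_mem_content z γ)

/-- A module generated by two coprime elements of the graded field is `t`-invertible. -/
theorem isTInvertible_span_pair_of_coprime [IsAddTorsionFree G] (hC : IsGradedSubfield C)
    (hD : HasHomogeneousComponents C (1 : Submodule D K))
    (hinv : ∀ S : Finset K, (∀ x ∈ S, ∃ γ, x ∈ C γ) → (∃ x ∈ S, x ≠ 0) →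
      IsTInvertible (Submodule.span D (S : Set K)))
    {p q : AddMonoidAlgebra K G} (hp : p ∈ hC.subring) (hq : q ∈ hC.subring)
    (hp0 : p ≠ 0) (hq0 : q ≠ 0)
    (hpq : ∀ a ∈ hC.subring, ∀ b ∈ hC.subring, a * q = b * p → ∃ c ∈ hC.subring, a = c * p) :
    IsTInvertible (Submodule.span D {coeffSum G K p, coeffSum G K q}) := by
  classical
  set f := coeffSum G K p with hf
  set g := coeffSum G K q with hg
  have hf0 : f ≠ 0 := fun h => hp0 (hC.eq_zero p hp h)
  set A := Submodule.span D {f, g} with hA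
  set J := content D p ⊔ content D q with hJ
  have hJinv : IsTInvertible J := by
    have := hinv (p.coeff.finite_range.toFinset ∪ q.coeff.finite_range.toFinset) (by
        intro x hx
        rcases Finset.mem_union.1 hx with h | h
        · obtain ⟨γ, rfl⟩ := (Set.Finite.mem_toFinset _).1 h
          exact ⟨γ, hp γ⟩
        · obtain ⟨γ, rfl⟩ := (Set.Finite.mem_toFinset _).1 h
          exact ⟨γ, hq γ⟩) (by
      by_contra! hcon
      exact hp0 (coeff_injective (Finsupp.ext fun γ => hcon (p.coeff γ) (by simp))))
    rwa [Finset.coe_union, Set.Finite.coe_toFinset, Set.Finite.coe_toFinset,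
      Submodule.span_union] at this
  have hAJ : A ≤ J := by
    rw [hA, Submodule.span_le]
    rintro _ (rfl | rfl)
    · exact coeffSum_mem fun γ => le_sup_left (a := content D p) (coeff_mem_content p γ)
    · exact coeffSum_mem fun γ => le_sup_right (b := content D q) (coeff_mem_content q γ)
  have hfA : f ∈ A := Submodule.subset_span (by simp)
  have hgA : g ∈ A := Submodule.subset_span (by simp)
  obtain ⟨B, hB, hB0, hB1, hBJ⟩ := hJinv
  obtain ⟨J', hJ', hJ'1, hBJ'⟩ := hB.exists_fg_le_mul hBJ
  -- The finitely generated `J' ⊆ J⁻¹ ⊆ A⁻¹` replaces `J⁻¹` to keep the witness finitely generated.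
  refine ⟨A * J', (Submodule.fg_span (by simp)).mul hJ', ?_, ?_, ?_⟩
  · refine Submodule.mul_ne_bot_of_ne_bot ?_ ?_
    · exact fun h => hf0 ((Submodule.mem_bot D).1 (h ▸ hfA))
    · rintro rfl
      rw [Submodule.mul_bot] at hBJ'
      exact hB0 (le_bot_iff.1 hBJ')
  · intro x hx
    refine hB1 (SemistarOperation.one_div_anti hBJ' ?_)
    rw [mul_comm J]
    -- It remains to see that `x y A ⊆ D` forces `x y J ⊆ D`. Coprimality writes `x y` as a sum of
    -- homogeneous elements, and the Gauss-type lemma treats its coefficients one by one.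
    have key : ∀ y ∈ J', x * y ∈ (1 : Submodule D K) / J := by
      intro y hy
      rw [Submodule.mem_one_div] at hx
      have hxf : x * y * f ∈ (1 : Submodule D K) := by
        rw [mul_assoc, mul_comm y]
        exact hx _ (Submodule.mul_mem_mul hfA hy)
      have hxg : x * y * g ∈ (1 : Submodule D K) := by
        rw [mul_assoc, mul_comm y]
        exact hx _ (Submodule.mul_mem_mul hgA hy)
      obtain ⟨a, ha, ha1, hae⟩ := hD _ hxf
      obtain ⟨b, hb, hb1, hbe⟩ := hD _ hxg
      obtain ⟨c, hc, rfl⟩ := hpq a ha b hb (hC.coeffSum_injOn (mul_mem ha hq) (mul_mem hb hp) (by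
        rw [map_mul, map_mul, hae, hbe, ← hf, ← hg]; ring))
      have hcxy : coeffSum G K c = x * y := by
        rw [map_mul, ← hf] at hae
        exact mul_right_cancel₀ hf0 hae
      obtain rfl : b = c * q := hC.coeffSum_injOn hb (mul_mem hc hq) (by
        rw [hbe, map_mul, hcxy])
      rw [← hcxy]
      refine coeffSum_mem fun γ => ?_
      rw [hJ, content, content, ← Submodule.span_union, Submodule.mem_one_div_span]
      rintro _ (⟨δ, rfl⟩ | ⟨δ, rfl⟩)
      · exact hC.coeff_mul_coeff_mem_one hinv hp hp0 ha1 γ δ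
      · exact hC.coeff_mul_coeff_mem_one hinv hq hq0 hb1 γ δ
    refine Submodule.mem_one_div.2 fun w hw => ?_
    induction hw using Submodule.mul_induction_on' with
    | mem_mul_mem y hy j hj => rw [← mul_assoc]; exact Submodule.mem_one_div.1 (key y hy) j hj
    | add y _ z _ hy hz => rw [mul_add]; exact add_mem hy hz
  · exact mul_le_mul' le_rfl (hJ'1.trans (SemistarOperation.one_div_anti hAJ))

/-- A graded domain in which all modules generated by finitely many homogeneous elements are
`t`-invertible is a P`v`MD. -/
theorem isPvMD [IsAddTorsionFree G] (hC : IsGradedSubfield C)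
    (hD : HasHomogeneousComponents C (1 : Submodule D K))
    (hfrac : ∀ x : K, ∃ p ∈ hC.subring, ∃ q ∈ hC.subring, q ≠ 0 ∧
      x = coeffSum G K p / coeffSum G K q)
    (hinv : ∀ S : Finset K, (∀ x ∈ S, ∃ γ, x ∈ C γ) → (∃ x ∈ S, x ≠ 0) →
      IsTInvertible (Submodule.span D (S : Set K))) : IsPvMD D K := by
  have hne : ∀ p ∈ hC.subring, p ≠ 0 → coeffSum G K p ≠ 0 := fun p hp hp0 h =>
    hp0 (hC.eq_zero p hp h)
  refine isPvMD_of_pair fun x y hx hy => ?_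
  obtain ⟨p₁, hp₁, q₁, hq₁, hq₁0, rfl⟩ := hfrac x
  obtain ⟨p₂, hp₂, q₂, hq₂, hq₂0, rfl⟩ := hfrac y
  have h₁ := hne q₁ hq₁ hq₁0
  have h₂ := hne q₂ hq₂ hq₂0
  have hp₁0 : p₁ * q₂ ≠ 0 := fun h => by
    apply_fun coeffSum G K at h
    simp only [map_mul, map_zero, mul_eq_zero, h₂, or_false] at h
    exact hx (by rw [h, zero_div])
  obtain ⟨d, hd, p, hp, q, hq, hdp, hdq, hpq⟩ :=
    hC.exists_coprime_factors (mul_mem hp₁ hq₂) (mul_mem hp₂ hq₁) hp₁0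
  have hd0 : coeffSum G K d ≠ 0 := hne d hd (by rintro rfl; exact hp₁0 (by rw [hdp, zero_mul]))
  apply_fun coeffSum G K at hdp hdq
  simp only [map_mul] at hdp hdq
  -- The generators are brought to a common denominator and the gcd `d` of the numerators is taken
  -- out; the common factor is a principal, hence invertible, module.
  have hx' : coeffSum G K p₁ / coeffSum G K q₁ =
      coeffSum G K d / (coeffSum G K q₁ * coeffSum G K q₂) * coeffSum G K p := by
    field_simp
    exact hdp
  have hy' : coeffSum G K p₂ / coeffSum G K q₂ =
      coeffSum G K d / (coeffSum G K q₁ * coeffSum G K q₂) * coeffSum G K q := by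
    field_simp
    exact hdq
  have hp0 : p ≠ 0 := by rintro rfl; exact hx (by rw [hx', map_zero, mul_zero])
  have hq0 : q ≠ 0 := by rintro rfl; exact hy (by rw [hy', map_zero, mul_zero])
  have hspan : Submodule.span D {coeffSum G K p₁ / coeffSum G K q₁,
        coeffSum G K p₂ / coeffSum G K q₂} =
      Submodule.span D {coeffSum G K d / (coeffSum G K q₁ * coeffSum G K q₂)} *
        Submodule.span D {coeffSum G K p, coeffSum G K q} := by
    rw [Submodule.span_mul_span, Set.singleton_mul, Set.image_pair, hx', hy']
  rw [hspan]
  exact (IsTInvertible.span_singleton (div_ne_zero hd0 (mul_ne_zero h₁ h₂))).mul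
    (hC.isTInvertible_span_pair_of_coprime hD hinv hp hq hp0 hq0 hpq)

end IsGradedSubfield

end GradedPvMD

/-! ### Homogeneous submodules of the quotient field -/

section HomogeneousComponents

variable {G K D : Type*} [AddCommGroup G] [Field K] [CommRing D] [Algebra D K]
  {C : G → AddSubgroup K}

namespace HasHomogeneousComponents

theorem exists_add {E : Submodule D K} {x y : K}
    (hx : ∃ p : AddMonoidAlgebra K G,
      (∀ γ, p.coeff γ ∈ C γ) ∧ (∀ γ, p.coeff γ ∈ E) ∧ coeffSum G K p = x)
    (hy : ∃ p : AddMonoidAlgebra K G,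
      (∀ γ, p.coeff γ ∈ C γ) ∧ (∀ γ, p.coeff γ ∈ E) ∧ coeffSum G K p = y) :
    ∃ p : AddMonoidAlgebra K G,
      (∀ γ, p.coeff γ ∈ C γ) ∧ (∀ γ, p.coeff γ ∈ E) ∧ coeffSum G K p = x + y := by
  obtain ⟨p, hp, hpE, rfl⟩ := hx
  obtain ⟨q, hq, hqE, rfl⟩ := hy
  exact ⟨p + q, fun γ => add_mem (hp γ) (hq γ), fun γ => add_mem (hpE γ) (hqE γ), map_add _ _ _⟩

theorem of_homogeneous {E : Submodule D K} {x : K} (hxE : x ∈ E) {γ : G} (hx : x ∈ C γ) :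
    ∃ p : AddMonoidAlgebra K G,
      (∀ γ, p.coeff γ ∈ C γ) ∧ (∀ γ, p.coeff γ ∈ E) ∧ coeffSum G K p = x := by
  classical
  refine ⟨single γ x, fun δ => ?_, fun δ => ?_, coeffSum_single γ x⟩ <;>
  · rw [coeff_single, Finsupp.single_apply]
    split_ifs with h
    · first
      | exact h ▸ hx
      | exact hxE
    · exact zero_mem _

theorem mul (hC : IsGradedSubfield C) {E F : Submodule D K} (hE : HasHomogeneousComponents C E)
    (hF : HasHomogeneousComponents C F) : HasHomogeneousComponents C (E * F) := by
  intro x hx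
  induction hx using Submodule.mul_induction_on' with
  | mem_mul_mem y hy z hz =>
    obtain ⟨p, hp, hpE, rfl⟩ := hE y hy
    obtain ⟨q, hq, hqF, rfl⟩ := hF z hz
    refine ⟨p * q, hC.subring.mul_mem hp hq, fun γ => ?_, map_mul _ _ _⟩
    rw [coeff_mul_apply_left]
    exact sum_mem fun δ _ => Submodule.mul_mem_mul (hpE δ) (hqF _)
  | add y _ z _ hy hz => exact exists_add hy hz

theorem span_set (hC : IsGradedSubfield C) (hD : HasHomogeneousComponents C (1 : Submodule D K))
    {S : Set K} (hS : ∀ x ∈ S, ∃ γ, x ∈ C γ) :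
    HasHomogeneousComponents C (Submodule.span D S) := by
  intro x hx
  induction hx using Submodule.span_induction with
  | mem x hx =>
    obtain ⟨γ, hγ⟩ := hS x hx
    exact of_homogeneous (Submodule.subset_span hx) hγ
  | zero => exact ⟨0, fun γ => zero_mem _, fun γ => zero_mem _, map_zero _⟩
  | add y z _ _ hy hz => exact exists_add hy hz
  | smul c y _ hy =>
    obtain ⟨p, hp, hpE, rfl⟩ := hy
    obtain ⟨q, hq, hq1, hqc⟩ := hD (algebraMap D K c)
      (by rw [Submodule.mem_one]; exact ⟨c, rfl⟩)
    refine ⟨q * p, hC.subring.mul_mem hq hp, fun γ => ?_, ?_⟩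
    · rw [coeff_mul_apply_left]
      refine sum_mem fun δ _ => ?_
      obtain ⟨r, hr⟩ := Submodule.mem_one.1 (hq1 δ)
      beta_reduce
      rw [← hr, ← Algebra.smul_def]
      exact Submodule.smul_mem _ r (hpE _)
    · rw [map_mul, hqc, Algebra.smul_def]

/-- Multiplying `b ∈ E⁻¹` by a nonzero homogeneous generator `a` lands in `D`, so `b` has
components: those of `b a` divided by `a`. They lie in `E⁻¹` because `b e` has its components in `D`
for each homogeneous generator `e`. -/
theorem one_div_span (hC : IsGradedSubfield C)
    (hD : HasHomogeneousComponents C (1 : Submodule D K)) {S : Set K}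
    (hS : ∀ x ∈ S, ∃ γ, x ∈ C γ) (hS0 : ∃ x ∈ S, x ≠ 0) :
    HasHomogeneousComponents C (1 / Submodule.span D S) := by
  intro b hb
  rw [Submodule.mem_one_div_span] at hb
  obtain ⟨a, ha, ha0⟩ := hS0
  obtain ⟨γ, hγ⟩ := hS a ha
  obtain ⟨p, hp, -, hpb⟩ := hD _ (hb a ha)
  have hq : p * single (-γ) a⁻¹ ∈ hC.subring :=
    mul_mem hp (hC.single_mem (hC.inv_mem_neg hγ))
  have hqb : coeffSum G K (p * single (-γ) a⁻¹) = b := by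
    rw [map_mul, coeffSum_single, hpb, mul_inv_cancel_right₀ ha0]
  refine ⟨_, hq, fun η => ?_, hqb⟩
  rw [Submodule.mem_one_div_span]
  intro e he
  obtain ⟨δ, hδ⟩ := hS e he
  have := hD.coeff_mem hC (mul_mem hq (hC.single_mem hδ))
    (by rw [map_mul, hqb, coeffSum_single]; exact hb e he) (η + δ)
  rwa [coeff_mul_single_add] at this

/-- A finitely generated submodule is contained in one generated by finitely many homogeneous
elements. -/
theorem exists_finset_homogeneous {B E : Submodule D K} (hE : HasHomogeneousComponents C E)
    (hB : B.FG) (hBE : B ≤ E) :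
    ∃ Y : Finset K, (∀ y ∈ Y, y ∈ E ∧ ∃ γ, y ∈ C γ) ∧ B ≤ Submodule.span D (Y : Set K) := by
  classical
  obtain ⟨S, rfl⟩ := hB
  choose! p hp hpE hpx using fun x (hx : x ∈ S) => hE x (hBE (Submodule.subset_span hx))
  refine ⟨S.biUnion fun x => (p x).coeff.finite_range.toFinset, fun y hy => ?_, ?_⟩
  · obtain ⟨x, hx, hy⟩ := Finset.mem_biUnion.1 hy
    obtain ⟨γ, rfl⟩ := (Set.Finite.mem_toFinset _).1 hy
    exact ⟨hpE x hx γ, γ, hp x hx γ⟩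
  · rw [Submodule.span_le]
    intro x hx
    rw [← hpx x hx]
    refine coeffSum_mem fun γ => Submodule.subset_span ?_
    exact Finset.mem_coe.2 (Finset.mem_biUnion.2 ⟨x, hx, by simp⟩)

end HasHomogeneousComponents

end HomogeneousComponents

/-! ### Homogeneous ideals and homogeneous generators -/

section HomogeneousIdeal

variable {D ι : Type*} [CommRing D] {𝒟 : ι → AddSubgroup D}

theorem isHomogeneousIdeal_span {S : Set D} (hS : ∀ x ∈ S, SetLike.IsHomogeneousElem 𝒟 x) :
    IsHomogeneousIdeal 𝒟 (Ideal.span S) := by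
  refine le_antisymm (Ideal.homogeneousCore'_le 𝒟 _) (Ideal.span_le.2 fun x hx => ?_)
  exact Ideal.subset_span ⟨⟨x, hS x hx⟩, Ideal.subset_span hx, rfl⟩

theorem IsHomogeneousIdeal.le_span {I : Ideal D} (hI : IsHomogeneousIdeal 𝒟 I) :
    I ≤ Ideal.span {x | x ∈ I ∧ SetLike.IsHomogeneousElem 𝒟 x} := by
  nth_rewrite 1 [← hI]
  refine Ideal.span_mono ?_
  rintro _ ⟨x, hx, rfl⟩
  exact ⟨hx, x.2⟩

theorem IsHomogeneousIdeal.exists_finset {I : Ideal D} (hI : IsHomogeneousIdeal 𝒟 I) (hfg : I.FG) :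
    ∃ S : Finset D, (∀ x ∈ S, SetLike.IsHomogeneousElem 𝒟 x) ∧ Ideal.span (S : Set D) = I := by
  have h : Ideal.span {x | x ∈ I ∧ SetLike.IsHomogeneousElem 𝒟 x} = I :=
    le_antisymm (Ideal.span_le.2 fun x hx => hx.1) hI.le_span
  rw [← h] at hfg
  obtain ⟨S, hS, hSI⟩ := (Submodule.fg_span_iff_fg_span_finset_subset _).1 hfg
  exact ⟨S, fun x hx => (hS hx).2, hSI.symm.trans h⟩

end HomogeneousIdeal

/-! ### The group of degrees -/

section GrothendieckGroup

open Algebra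

theorem GrothendieckAddGroup.exists_eq_sub {Γ : Type*} [AddCommMonoid Γ]
    (x : GrothendieckAddGroup Γ) :
    ∃ a b : Γ, x = GrothendieckAddGroup.of a - GrothendieckAddGroup.of b := by
  obtain ⟨⟨a, b⟩, h⟩ := (AddLocalization.addMonoidOf (⊤ : AddSubmonoid Γ)).surj x
  exact ⟨a, b, eq_sub_of_add_eq h⟩

/-- Writing `x - y = a - b` turns `n (x - y) = 0` into `n a = n b` in `Γ`, which embeds in its
quotient group. -/
theorem GrothendieckAddGroup.isAddTorsionFree (Γ : Type*) [AddCommMonoid Γ] [IsCancelAdd Γ]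
    [IsAddTorsionFree Γ] : IsAddTorsionFree (GrothendieckAddGroup Γ) := by
  refine ⟨fun n hn x y hxy => ?_⟩
  obtain ⟨a, b, hab⟩ := GrothendieckAddGroup.exists_eq_sub (x - y)
  have h : n • (x - y) = 0 := by rw [nsmul_sub]; exact sub_eq_zero.2 hxy
  rw [hab, nsmul_sub, sub_eq_zero, ← map_nsmul, ← map_nsmul] at h
  have h' := nsmul_right_injective hn (GrothendieckAddGroup.of_injective h)
  rw [← sub_eq_zero, hab, h', sub_self]

end GrothendieckGroup

theorem mem_one_subalgebra {R K : Type*} [CommRing R] [Field K] [Algebra R K]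
    {T : Subalgebra R K} {x : K} : x ∈ (1 : Submodule T K) ↔ x ∈ T := by
  rw [Submodule.mem_one]
  exact ⟨fun ⟨y, hy⟩ => hy ▸ y.2, fun h => ⟨⟨x, h⟩, rfl⟩⟩

/-! ### The homogeneous quotient field as a graded field -/

section QuotientField

open Algebra

variable {Γ R K : Type*} [AddCommMonoid Γ] [IsCancelAdd Γ] [DecidableEq Γ] [CommRing R]
  [IsDomain R] [Field K] [Algebra R K] [IsFractionRing R K] (𝒜 : Γ → AddSubgroup R) [GradedRing 𝒜]

theorem algebraMap_mem_component {α : Γ} {r : R} (hr : r ∈ 𝒜 α) :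
    algebraMap R K r ∈ homogeneousQuotientFieldComponent 𝒜 K (GrothendieckAddGroup.of α) :=
  Or.inr ⟨α, 0, r, hr, 1, SetLike.GradedOne.one_mem, one_ne_zero, by simp, by simp⟩

/-- Finitely many homogeneous fractions have a common denominator. -/
theorem exists_common_denominator {ι : Type*} (F : Finset ι) (d : ι → GrothendieckAddGroup Γ)
    (x : ι → K) (hx : ∀ i ∈ F, x i ∈ homogeneousQuotientFieldComponent 𝒜 K (d i)) :
    ∃ η, ∃ h ∈ 𝒜 η, h ≠ 0 ∧ ∀ i ∈ F, ∃ α, ∃ r ∈ 𝒜 α,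
      algebraMap R K h * x i = algebraMap R K r ∧
        (x i ≠ 0 → GrothendieckAddGroup.of α = d i + GrothendieckAddGroup.of η) := by
  classical
  induction F using Finset.induction_on with
  | empty => exact ⟨0, 1, SetLike.GradedOne.one_mem, one_ne_zero, by simp⟩
  | insert j F hj ih =>
    obtain ⟨η, h, hη, h0, hF⟩ := ih fun i hi => hx i (Finset.mem_insert_of_mem hi)
    rcases hx j (Finset.mem_insert_self j F) with hj0 | ⟨α, β, a, ha, b, hb, hb0, hd, hab⟩
    -- A zero fraction may carry any degree `d j`, so only nonzero fractions have their degree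
    -- recorded.
    · refine ⟨η, h, hη, h0, fun i hi => ?_⟩
      rcases Finset.mem_insert.1 hi with rfl | hi
      · exact ⟨0, 0, zero_mem _, by simp [hj0], fun h => absurd hj0 h⟩
      · exact hF i hi
    · have hb0' : algebraMap R K b ≠ 0 :=
        (map_ne_zero_iff _ (IsFractionRing.injective R K)).2 hb0
      refine ⟨η + β, h * b, SetLike.mul_mem_graded hη hb, mul_ne_zero h0 hb0, fun i hi => ?_⟩
      rcases Finset.mem_insert.1 hi with rfl | hi
      · refine ⟨η + α, h * a, SetLike.mul_mem_graded hη ha, ?_, fun _ => ?_⟩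
        · rw [hab, map_mul, map_mul]
          field_simp
        · rw [hd, map_add, map_add]
          abel
      · obtain ⟨α', r, hr, hrx, hdeg⟩ := hF i hi
        refine ⟨α' + β, r * b, SetLike.mul_mem_graded hr hb, ?_, fun h => ?_⟩
        · rw [map_mul, map_mul, ← hrx]
          ring
        · rw [map_add, map_add, hdeg h]
          abel

/-- Directness of the sum comes from that of `R`: a common denominator turns a relation between
fractions into one between elements of `R`, and shifts all degrees by the same amount, so distinct
ones stay distinct. -/
theorem isGradedSubfield_component :
    IsGradedSubfield (homogeneousQuotientFieldComponent 𝒜 K) where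
  one_mem_zero := by
    simpa using algebraMap_mem_component (K := K) 𝒜 (SetLike.GradedOne.one_mem (A := 𝒜))
  mul_mem_add := by
    rintro γ δ _ _ (rfl | ⟨α, β, a, ha, b, hb, hb0, rfl, rfl⟩) hy
    · rw [zero_mul]; exact zero_mem _
    rcases hy with rfl | ⟨α', β', a', ha', b', hb', hb0', rfl, rfl⟩
    · rw [mul_zero]; exact zero_mem _
    refine Or.inr ⟨α + α', β + β', a * a', SetLike.mul_mem_graded ha ha', b * b',
      SetLike.mul_mem_graded hb hb', mul_ne_zero hb0 hb0', ?_, ?_⟩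
    · rw [map_add, map_add]; abel
    · rw [map_mul, map_mul, div_mul_div_comm]
  inv_mem_neg := by
    rintro γ _ (rfl | ⟨α, β, a, ha, b, hb, hb0, rfl, rfl⟩)
    · rw [inv_zero]; exact zero_mem _
    rcases eq_or_ne a 0 with rfl | ha0
    · rw [map_zero, zero_div, inv_zero]; exact zero_mem _
    · exact Or.inr ⟨β, α, b, hb, a, ha, ha0, by abel, by rw [inv_div]⟩
  eq_zero := by
    intro p hp hsum
    by_contra hp0
    obtain ⟨γ₀, hγ₀⟩ : p.coeff.support.Nonempty := by simpa using hp0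
    obtain ⟨η, h, hη, h0, hF⟩ := exists_common_denominator 𝒜 p.coeff.support id p.coeff
      fun γ _ => hp γ
    choose! α r hr hrx hdeg using hF
    have hinj := IsFractionRing.injective R K
    have hsum₁ : ∑ γ ∈ p.coeff.support, r γ = 0 := by
      apply hinj
      rw [map_sum, map_zero, ← Finset.sum_congr rfl hrx, ← Finset.mul_sum, ← coeffSum_eq_sum, hsum,
        mul_zero]
    have hr0 : r γ₀ = 0 := by
      have hdec := congrArg (fun z => (DirectSum.decompose 𝒜 z (α γ₀) : R)) hsum₁
      simp only [DirectSum.decompose_sum, DirectSum.decompose_zero, DirectSum.zero_apply,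
        ZeroMemClass.coe_zero, DirectSum.sum_apply, AddSubmonoidClass.coe_finsetSum] at hdec
      rw [Finset.sum_eq_single γ₀] at hdec
      · rwa [DirectSum.decompose_of_mem_same 𝒜 (hr γ₀ hγ₀)] at hdec
      · intro γ hγ hne
        refine DirectSum.decompose_of_mem_ne 𝒜 (hr γ hγ) fun heq => hne ?_
        have h1 := hdeg γ hγ (Finsupp.mem_support_iff.1 hγ)
        have h2 := hdeg γ₀ hγ₀ (Finsupp.mem_support_iff.1 hγ₀)
        rw [heq, h2] at h1
        exact (add_right_cancel h1).symm
      · exact fun h => absurd hγ₀ h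
    have := hrx γ₀ hγ₀
    rw [hr0, map_zero, mul_eq_zero] at this
    rcases this with h' | h'
    · exact h0 (hinj (by rw [h', map_zero]))
    · exact Finsupp.mem_support_iff.1 hγ₀ h'

theorem exists_decomposition (r : R) :
    ∃ p : AddMonoidAlgebra K (GrothendieckAddGroup Γ),
      (∀ γ, p.coeff γ ∈ homogeneousQuotientFieldComponent 𝒜 K γ) ∧
      (∀ γ, p.coeff γ ∈ (1 : Submodule R K)) ∧ coeffSum _ K p = algebraMap R K r ∧
      ∀ α, p.coeff (GrothendieckAddGroup.of α) = algebraMap R K (DirectSum.decompose 𝒜 r α) := by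
  classical
  set S := (DirectSum.decompose 𝒜 r).support
  let f : Γ → AddMonoidAlgebra K (GrothendieckAddGroup Γ) := fun α =>
    single (GrothendieckAddGroup.of α) (algebraMap R K (DirectSum.decompose 𝒜 r α))
  refine ⟨∑ α ∈ S, f α, ?_, fun γ => ?_, ?_, fun α => ?_⟩
  · exact (isGradedSubfield_component (K := K) 𝒜).subring.sum_mem fun α _ =>
      (isGradedSubfield_component (K := K) 𝒜).single_mem
        (algebraMap_mem_component 𝒜 (SetLike.coe_mem _))
  · rw [coeff_sum, Finsupp.finsetSum_apply]
    refine sum_mem fun α _ => ?_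
    simp only [f, coeff_single, Finsupp.single_apply]
    split_ifs
    · exact Submodule.mem_one.2 ⟨_, rfl⟩
    · exact zero_mem _
  · rw [map_sum]
    simp only [f, coeffSum_single]
    rw [← map_sum, DirectSum.sum_support_decompose]
  · rw [coeff_sum, Finsupp.finsetSum_apply, Finset.sum_eq_single α]
    · simp [f]
    · intro β _ hβ
      simp only [f, coeff_single]
      exact Finsupp.single_eq_of_ne' fun h => hβ (GrothendieckAddGroup.of_injective h)
    · intro hα
      have : DirectSum.decompose 𝒜 r α = 0 := by simpa [S] using hα
      simp [f, this]

theorem hasHomogeneousComponents_one :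
    HasHomogeneousComponents (homogeneousQuotientFieldComponent 𝒜 K) (1 : Submodule R K) := by
  intro x hx
  obtain ⟨r, rfl⟩ := Submodule.mem_one.1 hx
  obtain ⟨p, hp, hp1, hpr, -⟩ := exists_decomposition (K := K) 𝒜 r
  exact ⟨p, hp, hp1, hpr⟩

/-- By uniqueness of components in `K`, the decomposition of `r` in `R` has its only nonzero term in
degree `γ`. -/
theorem isHomogeneousElem_of_algebraMap_mem {r : R} {γ : GrothendieckAddGroup Γ}
    (hr : algebraMap R K r ∈ homogeneousQuotientFieldComponent 𝒜 K γ) :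
    SetLike.IsHomogeneousElem 𝒜 r := by
  classical
  rcases eq_or_ne r 0 with rfl | hr0
  · exact ⟨0, zero_mem _⟩
  obtain ⟨p, hp, -, hpr, hpα⟩ := exists_decomposition (K := K) 𝒜 r
  have hC := isGradedSubfield_component (K := K) 𝒜
  obtain rfl := hC.coeffSum_injOn hp (hC.single_mem hr) (by rw [hpr, coeffSum_single])
  have hne : DirectSum.decompose 𝒜 r ≠ 0 := fun h =>
    hr0 ((DirectSum.decompose 𝒜).injective (h.trans (DirectSum.decompose_zero 𝒜).symm))
  obtain ⟨α, hα⟩ := DFinsupp.ne_iff.1 hne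
  have h := hpα α
  rw [coeff_single, Finsupp.single_apply] at h
  split_ifs at h
  · refine ⟨α, ?_⟩
    rw [IsFractionRing.injective R K h]
    exact SetLike.coe_mem _
  · exact absurd (Subtype.ext (IsFractionRing.injective R K (by rw [← h]; simp))) hα

theorem exists_fraction (x : K) :
    ∃ p ∈ (isGradedSubfield_component (K := K) 𝒜).subring,
      ∃ q ∈ (isGradedSubfield_component (K := K) 𝒜).subring, q ≠ 0 ∧
        x = coeffSum _ K p / coeffSum _ K q := by
  obtain ⟨a, b, hb, rfl⟩ := IsFractionRing.div_surjective R x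
  obtain ⟨p, hp, -, hpa, -⟩ := exists_decomposition (K := K) 𝒜 a
  obtain ⟨q, hq, -, hqb, -⟩ := exists_decomposition (K := K) 𝒜 b
  refine ⟨p, hp, q, hq, ?_, by rw [hpa, hqb]⟩
  rintro rfl
  rw [map_zero] at hqb
  exact nonZeroDivisors.ne_zero hb (IsFractionRing.injective R K (by rw [← hqb, map_zero]))

theorem component_le_homogeneousQuotientField {γ : GrothendieckAddGroup Γ} {x : K}
    (hx : x ∈ homogeneousQuotientFieldComponent 𝒜 K γ) : x ∈ homogeneousQuotientField 𝒜 K := by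
  rcases hx with rfl | ⟨α, β, a, -, b, hb, hb0, -, rfl⟩
  · exact zero_mem _
  · exact ⟨a, b, ⟨⟨β, hb⟩, mem_nonZeroDivisors_of_ne_zero hb0⟩, div_eq_mul_inv _ _⟩

theorem isHomogeneousOverring_iff {T : Subalgebra R K} :
    IsHomogeneousOverring 𝒜 T ↔
      HasHomogeneousComponents (homogeneousQuotientFieldComponent 𝒜 K) (1 : Submodule T K) := by
  constructor
  · intro hT x hx
    have hx' : x ∈ T.toSubring.toAddSubgroup := mem_one_subalgebra.1 hx
    rw [hT.eq_iSup] at hx'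
    clear hx
    induction hx' using AddSubgroup.iSup_induction' with
    | hp γ x hx =>
      exact HasHomogeneousComponents.of_homogeneous (mem_one_subalgebra.2 hx.1) hx.2
    | h1 => exact ⟨0, fun γ => zero_mem _, fun γ => zero_mem _, map_zero _⟩
    | hadd x y _ _ ihx ihy => exact HasHomogeneousComponents.exists_add ihx ihy
  · intro h
    refine ⟨fun x hx => ?_, le_antisymm (fun x hx => ?_) (iSup_le fun γ => inf_le_left)⟩
    · obtain ⟨p, hp, -, rfl⟩ := h x (mem_one_subalgebra.2 hx)
      exact coeffSum_mem fun γ => component_le_homogeneousQuotientField 𝒜 (hp γ)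
    · obtain ⟨p, hp, hpT, rfl⟩ := h x (mem_one_subalgebra.2 hx)
      exact coeffSum_mem fun γ => AddSubgroup.mem_iSup_of_mem γ ⟨mem_one_subalgebra.1 (hpT γ), hp γ⟩

/-- Finitely many homogeneous fractions become elements of `R` after multiplication with a common
denominator. -/
theorem exists_finset_image_eq {S : Finset K}
    (hS : ∀ x ∈ S, ∃ γ, x ∈ homogeneousQuotientFieldComponent 𝒜 K γ) :
    ∃ h : K, h ≠ 0 ∧ ∃ S' : Finset R, (∀ r ∈ S', SetLike.IsHomogeneousElem 𝒜 r) ∧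
      algebraMap R K '' S' = (fun x => h * x) '' S := by
  classical
  choose! d hd using hS
  obtain ⟨η, h, -, h0, hF⟩ := exists_common_denominator 𝒜 S d id hd
  choose! α r hr hrx _ using hF
  refine ⟨algebraMap R K h, (map_ne_zero_iff _ (IsFractionRing.injective R K)).2 h0,
    S.image r, ?_, ?_⟩
  · intro x hx
    obtain ⟨y, hy, rfl⟩ := Finset.mem_image.1 hx
    exact ⟨α y, hr y hy⟩
  · rw [Finset.coe_image, Set.image_image]
    exact Set.image_congr fun y hy => (hrx y hy).symm

end QuotientField

theorem Submodule.mul_mul_one_div_le {D K : Type*} [CommRing D] [Field K] [Algebra D K]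
    (E F : Submodule D K) : E * F * (1 / (E * F)) ≤ F * (1 / F) := by
  rw [mul_comm E F, mul_assoc]
  refine mul_le_mul' le_rfl ?_
  rw [Submodule.le_div_iff_mul_le, mul_comm, ← mul_assoc]
  exact Submodule.mul_one_div_self_le _

/-- Carries a witness of invertibility from `R` to `T`: an element multiplying `S` into `R`
multiplies it into `T`. -/
theorem coeSubmodule_map_le {R K : Type*} [CommRing R] [Field K] [Algebra R K]
    {T : Subalgebra R K} {F : Ideal R} {S : Set K}
    (h : IsLocalization.coeSubmodule K F ≤ Submodule.span R S * (1 / Submodule.span R S)) :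
    IsLocalization.coeSubmodule K (F.map (algebraMap R T)) ≤
      Submodule.span T S * (1 / Submodule.span T S) := by
  rw [Ideal.map, IsLocalization.coeSubmodule_span, Submodule.span_le]
  rintro _ ⟨_, ⟨f, hf, rfl⟩, rfl⟩
  rw [← IsScalarTower.algebraMap_apply, SetLike.mem_coe]
  have hf' := h ((IsLocalization.mem_coeSubmodule K F).2 ⟨f, hf, rfl⟩)
  generalize algebraMap R K f = x at hf' ⊢
  induction hf' using Submodule.mul_induction_on' with
  | mem_mul_mem y hy z hz =>
    refine Submodule.mul_mem_mul (Submodule.span_subset_span R T S hy) ?_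
    rw [Submodule.mem_one_div_span] at hz ⊢
    intro w hw
    obtain ⟨r, hr⟩ := Submodule.mem_one.1 (hz w hw)
    rw [← hr]
    exact mem_one_subalgebra.2 (T.algebraMap_mem r)
  | add y _ z _ hy hz => exact add_mem hy hz

/-! ### Linked overrings of a graded P⋆MD -/

section Forward

open Algebra

variable {Γ R K : Type*} [AddCommMonoid Γ] [IsCancelAdd Γ] [DecidableEq Γ] [CommRing R]
  [IsDomain R] [Field K] [Algebra R K] [IsFractionRing R K] {𝒜 : Γ → AddSubgroup R} [GradedRing 𝒜]

/-- In a graded P`⋆`MD, the product of a module generated by homogeneous elements and its inverse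
contains a finitely generated homogeneous ideal `F` with `F^⋆ = R^⋆`. -/
theorem IsGradedPStarMD.exists_ideal {s : SemistarOperation R K} (h : IsGradedPStarMD 𝒜 s)
    {S : Finset K} (hS : ∀ x ∈ S, ∃ γ, x ∈ homogeneousQuotientFieldComponent 𝒜 K γ)
    (hS0 : ∃ x ∈ S, x ≠ 0) :
    ∃ F : Ideal R, F ≠ ⊥ ∧ F.FG ∧ IsHomogeneousIdeal 𝒜 F ∧
      s (IsLocalization.coeSubmodule K F) = s 1 ∧
      IsLocalization.coeSubmodule K F ≤
        Submodule.span R (S : Set K) * (1 / Submodule.span R (S : Set K)) := by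
  classical
  have hC := isGradedSubfield_component (K := K) 𝒜
  have hR := hasHomogeneousComponents_one (K := K) 𝒜
  have hinj := IsFractionRing.injective R K
  obtain ⟨k, hk0, S', hS', hSS'⟩ := exists_finset_image_eq 𝒜 hS
  set E := Submodule.span R (S : Set K) with hE
  have hI : IsLocalization.coeSubmodule K (Ideal.span (S' : Set R)) = Submodule.span R {k} * E := by
    rw [IsLocalization.coeSubmodule_span, hSS', hE, Submodule.span_mul_span, Set.singleton_mul]
  have hI0 : Ideal.span (S' : Set R) ≠ ⊥ := by
    intro h0
    rw [h0, IsLocalization.coeSubmodule_bot] at hI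
    obtain ⟨x, hx, hx0⟩ := hS0
    have := Submodule.mul_mem_mul (Submodule.mem_span_singleton_self (R := R) k)
      (Submodule.subset_span (R := R) (Finset.mem_coe.2 hx))
    rw [← hE, ← hI, Submodule.mem_bot] at this
    exact mul_ne_zero hk0 hx0 this
  obtain ⟨B, hB, hBI, hB1⟩ := isStarInvertible_iff.1
    (h _ ⟨S', rfl⟩ hI0 (isHomogeneousIdeal_span fun x hx => hS' x hx))
  rw [hI] at hBI
  have hBE := hBI.trans (Submodule.mul_mul_one_div_le _ _)
  have hEE : HasHomogeneousComponents (homogeneousQuotientFieldComponent 𝒜 K) (E * (1 / E)) :=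
    .mul hC (.span_set hC hR hS) (.one_div_span hC hR hS hS0)
  -- The witness `B` need not be homogeneous; the components of its generators stay in `E E⁻¹` and
  -- generate a larger module.
  obtain ⟨Y, hY, hBY⟩ := hEE.exists_finset_homogeneous hB hBE
  have hYE : Submodule.span R (Y : Set K) ≤ E * (1 / E) :=
    Submodule.span_le.2 fun y hy => (hY y hy).1
  have hF : IsLocalization.coeSubmodule K (Ideal.span (algebraMap R K ⁻¹' (Y : Set K))) =
      Submodule.span R (Y : Set K) := by
    rw [IsLocalization.coeSubmodule_span, Set.image_preimage_eq_of_subset]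
    intro y hy
    exact Submodule.mem_one.1 (Submodule.mul_one_div_self_le E (hY y hy).1)
  have h1 : (1 : K) ∈ s (Submodule.span R (Y : Set K)) := s.monotone hBY hB1
  refine ⟨Ideal.span (algebraMap R K ⁻¹' (Y : Set K)), ?_, ?_, ?_, ?_, ?_⟩
  · intro h0
    rw [h0, IsLocalization.coeSubmodule_bot] at hF
    rw [← hF, s.map_bot, Submodule.mem_bot] at h1
    exact one_ne_zero h1
  · exact Submodule.fg_span (Y.finite_toSet.preimage hinj.injOn)
  · refine isHomogeneousIdeal_span fun r hr => ?_
    obtain ⟨γ, hγ⟩ := (hY _ hr).2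
    exact isHomogeneousElem_of_algebraMap_mem 𝒜 hγ
  · rw [hF, s.eq_apply_one_iff (hYE.trans (Submodule.mul_one_div_self_le E))]
    exact h1
  · rw [hF]
    exact hYE

theorem isPvMD_overring [IsAddTorsionFree Γ] {T : Subalgebra R K}
    (hT : IsHomogeneousOverring 𝒜 T)
    (hinv : ∀ S : Finset K, (∀ x ∈ S, ∃ γ, x ∈ homogeneousQuotientFieldComponent 𝒜 K γ) →
      (∃ x ∈ S, x ≠ 0) → IsTInvertible (Submodule.span T (S : Set K))) : IsPvMD T K :=
  have := GrothendieckAddGroup.isAddTorsionFree Γ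
  (isGradedSubfield_component (K := K) 𝒜).isPvMD ((isHomogeneousOverring_iff 𝒜).1 hT)
    (exists_fraction 𝒜) hinv

theorem IsGradedPStarMD.isPvMD_of_linked [IsAddTorsionFree Γ] {s : SemistarOperation R K}
    (h : IsGradedPStarMD 𝒜 s) {T : Subalgebra R K}
    (hT : IsHomogeneouslyLinked 𝒜 s T (SemistarOperation.t T K)) : IsPvMD T K := by
  refine isPvMD_overring hT.isHomogeneousOverring fun S hS hS0 => ?_
  obtain ⟨F, hF0, hFfg, hFh, hFs, hFS⟩ := h.exists_ideal hS hS0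
  have h1 : (1 : K) ∈ SemistarOperation.t T K
      (IsLocalization.coeSubmodule K (F.map (algebraMap R T))) := by
    rw [hT.linked F hF0 hFfg hFh hFs]
    exact SemistarOperation.le_self _ _ Submodule.one_mem_one
  obtain ⟨B, hB, hBF, hB1⟩ := h1
  obtain ⟨hB0, hB1⟩ := SemistarOperation.one_mem_v_iff.1 hB1
  exact ⟨B, hB, hB0, hB1, hBF.trans (coeSubmodule_map_le hFS)⟩

theorem IsGradedPStarMD.isGradedPrufer_of_linked {s : SemistarOperation R K}
    (h : IsGradedPStarMD 𝒜 s) {T : Subalgebra R K}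
    (hT : IsHomogeneouslyLinked 𝒜 s T (SemistarOperation.d T K)) :
    IsGradedPrufer K (overringComponent 𝒜 T) := by
  classical
  intro I hfg hI0 hI
  obtain ⟨S, hS, rfl⟩ := hI.exists_finset hfg
  obtain ⟨F, hF0, hFfg, hFh, hFs, hFS⟩ := h.exists_ideal (S := S.image (algebraMap T K))
    (by
      intro x hx
      obtain ⟨y, hy, rfl⟩ := Finset.mem_image.1 hx
      exact hS y hy) (by
      by_contra! hcon
      refine hI0 (Ideal.span_eq_bot.2 fun x hx => ?_)
      exact Subtype.ext (hcon _ (Finset.mem_image_of_mem _ hx)))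
  rw [isStarInvertible_iff, IsLocalization.coeSubmodule_span, ← Finset.coe_image]
  refine ⟨1, ?_, ?_, Submodule.one_mem_one⟩
  · rw [Submodule.one_eq_span]
    exact Submodule.fg_span_singleton 1
  · exact (hT.linked F hF0 hFfg hFh hFs).symm.le.trans (coeSubmodule_map_le hFS)

/-- Invertible modules are `t`-invertible, so the criterion for P`v`MDs applies. A common
denominator in `R` turns a module generated by homogeneous fractions into a homogeneous ideal of
`T`. -/
theorem IsGradedPrufer.isIntegrallyClosed_overring [IsAddTorsionFree Γ] {T : Subalgebra R K}
    (hT : IsHomogeneousOverring 𝒜 T) (h : IsGradedPrufer K (overringComponent 𝒜 T)) :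
    IsIntegrallyClosed T := by
  classical
  refine (isPvMD_overring hT fun S hS hS0 => ?_).isIntegrallyClosed
  obtain ⟨k, hk0, S', hS', hSS'⟩ := exists_finset_image_eq 𝒜 hS
  set E := Submodule.span T (S : Set K) with hE
  have hI : IsLocalization.coeSubmodule K (Ideal.span (algebraMap R T '' (S' : Set R))) =
      Submodule.span T {k} * E := by
    rw [IsLocalization.coeSubmodule_span, Set.image_image]
    simp only [← IsScalarTower.algebraMap_apply]
    rw [hSS', hE, Submodule.span_mul_span, Set.singleton_mul]
  have hI0 : Ideal.span (algebraMap R T '' (S' : Set R)) ≠ ⊥ := by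
    intro h0
    rw [h0, IsLocalization.coeSubmodule_bot] at hI
    obtain ⟨x, hx, hx0⟩ := hS0
    have := Submodule.mul_mem_mul (Submodule.mem_span_singleton_self (R := T) k)
      (Submodule.subset_span (R := T) (Finset.mem_coe.2 hx))
    rw [← hE, ← hI, Submodule.mem_bot] at this
    exact mul_ne_zero hk0 hx0 this
  have hinv := h _ (Submodule.fg_span (S'.finite_toSet.image _)) hI0 (by
    refine isHomogeneousIdeal_span ?_
    rintro _ ⟨r, hr, rfl⟩
    obtain ⟨α, hα⟩ := hS' r hr
    exact ⟨GrothendieckAddGroup.of α, algebraMap_mem_component (K := K) 𝒜 hα⟩)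
  rw [isStarInvertible_iff, hI] at hinv
  obtain ⟨B, -, hBI, hB1⟩ := hinv
  exact IsTInvertible.of_one_mem (Submodule.mul_mul_one_div_le _ _ (hBI hB1))

end Forward

/-! ### Primes that are maximal for a semistar operation of finite type -/

section MaximalIdeal

variable {D K : Type*} [CommRing D] [Field K] [Algebra D K]

/-- An integral submodule whose `⋆_f`-closure does not contain `1` lies in a prime one. -/
theorem SemistarOperation.exists_prime_of_one_notMem (s : SemistarOperation D K)
    {J : Submodule D K} (hJ : J ≤ 1) (hJs : (1 : K) ∉ s.finiteType J) :
    ∃ Q : Submodule D K, J ≤ Q ∧ (1 : K) ∉ s.finiteType Q ∧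
      ∀ a ∈ (1 : Submodule D K), ∀ b ∈ (1 : Submodule D K), a * b ∈ Q → a ∈ Q ∨ b ∈ Q := by
  have hchain : ∀ c ⊆ {N : Submodule D K | N ≤ 1 ∧ (1 : K) ∉ s.finiteType N}, IsChain (· ≤ ·) c →
      ∀ N ∈ c, ∃ ub ∈ {N : Submodule D K | N ≤ 1 ∧ (1 : K) ∉ s.finiteType N}, ∀ M ∈ c, M ≤ ub := by
    intro c hc hchain N hN
    -- Finite type matters here: if `1` is in the closure of the union, it is in that of a finitely
    -- generated submodule, which lies in one member of the chain.
    refine ⟨sSup c, ⟨sSup_le fun M hM => (hc hM).1, ?_⟩, fun M hM => le_sSup hM⟩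
    rintro ⟨F, hF, hFc, hF1⟩
    obtain ⟨M, hM, hFM⟩ := (CompleteLattice.isCompactElement_iff_le_of_directed_sSup_le _ F).1
      ((Submodule.fg_iff_compact F).1 hF) c ⟨N, hN⟩ hchain.directedOn hFc
    exact (hc hM).2 ⟨F, hF, hFM, hF1⟩
  obtain ⟨Q, hJQ, hQ⟩ := zorn_le_nonempty₀ _ hchain J ⟨hJ, hJs⟩
  refine ⟨Q, hJQ, hQ.prop.2, fun a ha b hb hab => ?_⟩
  by_contra! hcon
  -- By maximality, adding an element outside `Q` brings `1` into the closure. Doing this for both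
  -- `a` and `b` gives a product inside `Q`, a contradiction.
  have key : ∀ z ∈ (1 : Submodule D K), z ∉ Q →
      (1 : K) ∈ s.finiteType (Q ⊔ Submodule.span D {z}) := by
    intro z hz hzQ
    by_contra h1
    refine hzQ (hQ.le_of_ge ⟨sup_le hQ.prop.1 ?_, h1⟩ le_sup_left
      (le_sup_right (a := Q) (Submodule.mem_span_singleton_self z)))
    exact (Submodule.span_singleton_le_iff_mem z 1).2 hz
  refine hQ.prop.2 (s.finiteType.monotone ?_
    (s.finiteType.one_mem_apply_mul (key a ha hcon.1) (key b hb hcon.2)))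
  have hQQ : Q * Q ≤ Q := (mul_le_mul' hQ.prop.1 le_rfl).trans_eq (one_mul Q)
  rw [Submodule.mul_sup, Submodule.sup_mul, Submodule.sup_mul]
  refine sup_le (sup_le hQQ ?_) (sup_le ?_ ?_)
  · refine (mul_le_mul' ?_ le_rfl).trans_eq (one_mul Q)
    exact (Submodule.span_singleton_le_iff_mem a 1).2 ha
  · refine (mul_le_mul' le_rfl ?_).trans_eq (mul_one Q)
    exact (Submodule.span_singleton_le_iff_mem b 1).2 hb
  · rw [Submodule.span_mul_span, Set.singleton_mul_singleton, Submodule.span_singleton_le_iff_mem]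
    exact hab

end MaximalIdeal

/-! ### Homogeneous relations and the `u, u⁻¹` argument -/

section Relation

variable {G R K : Type*} [AddCommGroup G] [CommRing R] [Field K] [Algebra R K]
  {C : G → AddSubgroup K}

/-- The leading coefficient times a root of a polynomial is integral. -/
theorem mul_mem_of_sum_eq_zero {S : Subalgebra R K} [IsFractionRing S K] [IsIntegrallyClosed S]
    {x : K} {n : ℕ} {c : ℕ → K} (hc : ∀ i, c i ∈ S)
    (hsum : ∑ i ∈ Finset.range (n + 1), c i * x ^ i = 0) : c n * x ∈ S := by
  rcases eq_or_ne (c n) 0 with h0 | h0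
  · rw [h0, zero_mul]; exact zero_mem _
  let q : Polynomial S := ∑ i ∈ Finset.range (n + 1), Polynomial.monomial i (⟨c i, hc i⟩ : S)
  have hcoeff : q.coeff n = ⟨c n, hc n⟩ := by
    simp [q, Polynomial.finsetSum_coeff, Polynomial.coeff_monomial]
  have hdeg : q.natDegree = n := by
    refine Polynomial.natDegree_eq_of_le_of_coeff_ne_zero ?_ ?_
    · refine Polynomial.natDegree_sum_le_of_forall_le _ _ fun i hi => ?_
      exact (Polynomial.natDegree_monomial_le _).trans (Nat.lt_succ_iff.1 (Finset.mem_range.1 hi))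
    · rw [hcoeff]
      exact fun h => h0 (congrArg Subtype.val h)
  have hq : Polynomial.aeval x q = 0 := by
    simp only [q, map_sum, Polynomial.aeval_monomial]
    exact hsum
  have hint := isIntegral_leadingCoeff_smul q x hq
  rw [Polynomial.leadingCoeff, hdeg, hcoeff] at hint
  obtain ⟨y, hy⟩ := IsIntegrallyClosed.isIntegral_iff.1 hint
  have : c n * x = algebraMap S K y := by rw [hy]; rfl
  rw [this]
  exact y.2

/-- A homogeneous element that satisfies a homogeneous relation in which its first power has a unit
as coefficient is in `S` or has its inverse there, if `S` is integrally closed and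
local with respect to elements of degree zero. -/
theorem mem_or_inv_mem_of_sum_eq_zero (hC : IsGradedSubfield C) {S : Subalgebra R K}
    [IsFractionRing S K] [IsIntegrallyClosed S]
    (hloc : ∀ w ∈ S, w ∈ C 0 → ∀ c ∈ S, c ∈ C 0 → c ≠ 0 → c⁻¹ ∈ S →
      (w ≠ 0 ∧ w⁻¹ ∈ S) ∨ (w + c ≠ 0 ∧ (w + c)⁻¹ ∈ S))
    {γ : G} {x : K} (hx : x ∈ C γ) (n : ℕ) :
    ∀ c : ℕ → K, (∀ i, c i ∈ S) → (∀ i : ℕ, c i ∈ C ((1 - (i : ℤ)) • γ)) → c 1 ≠ 0 → (c 1)⁻¹ ∈ S →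
      ∑ i ∈ Finset.range (n + 2), c i * x ^ i = 0 → x ∈ S ∨ x⁻¹ ∈ S := by
  induction n with
  | zero =>
    intro c hcS _ h1 h1S hsum
    left
    rw [Finset.sum_range_succ, Finset.sum_range_one, pow_zero, mul_one, pow_one] at hsum
    have : x = -(c 0) * (c 1)⁻¹ := by
      rw [eq_mul_inv_iff_mul_eq₀ h1]
      linear_combination hsum
    rw [this]
    exact mul_mem (neg_mem (hcS 0)) h1S
  | succ n ih =>
    intro c hcS hcC h1 h1S hsum
    have hy : c (n + 2) * x ∈ S := mul_mem_of_sum_eq_zero hcS hsum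
    have hyC : c (n + 2) * x ∈ C ((1 - ((n + 1 : ℕ) : ℤ)) • γ) := by
      have := hC.mul_mem_add (hcC (n + 2)) hx
      convert this using 2
      push_cast
      module
    -- The two top terms merge as `(c_{n+2} x + c_{n+1}) x^{n+1}`, which lowers the degree of the
    -- relation.
    let c' : ℕ → K := Function.update c (n + 1) (c (n + 2) * x + c (n + 1))
    have hc'S : ∀ i, c' i ∈ S := by
      intro i
      rcases eq_or_ne i (n + 1) with rfl | hi
      · simpa [c'] using add_mem hy (hcS (n + 1))
      · simpa [c', hi] using hcS i
    have hc'C : ∀ i : ℕ, c' i ∈ C ((1 - (i : ℤ)) • γ) := by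
      intro i
      rcases eq_or_ne i (n + 1) with rfl | hi
      · simpa [c'] using add_mem hyC (hcC (n + 1))
      · simpa [c', hi] using hcC i
    have hsum₁ : ∑ i ∈ Finset.range (n + 2), c' i * x ^ i = 0 := by
      rw [Finset.sum_range_succ, Finset.sum_range_succ] at hsum
      rw [Finset.sum_range_succ]
      have : ∑ i ∈ Finset.range (n + 1), c' i * x ^ i = ∑ i ∈ Finset.range (n + 1), c i * x ^ i :=
        Finset.sum_congr rfl fun i hi => by
          simp [c', (Finset.mem_range.1 hi).ne]
      rw [this]
      simp only [c', Function.update_self]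
      linear_combination hsum
    -- Only the merge of the quadratic term changes the coefficient of `x`. There `w = c₂ x` has
    -- degree zero, so locality applies: either `w` is a unit and `x⁻¹ = c₂ w⁻¹`, or the new
    -- coefficient `w + c₁` is a unit.
    rcases Nat.eq_zero_or_pos n with rfl | hn
    · have hw0 : c 2 * x ∈ C 0 := by simpa using hyC
      have hc0 : c 1 ∈ C 0 := by simpa using hcC 1
      rcases hloc _ hy hw0 _ (hcS 1) hc0 h1 h1S with ⟨hw, hwS⟩ | ⟨hw, hwS⟩
      · right
        have : x⁻¹ = c 2 * (c 2 * x)⁻¹ := by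
          rw [mul_inv, mul_inv_cancel_left₀ (left_ne_zero_of_mul hw)]
        rw [this]
        exact mul_mem (hcS 2) hwS
      · exact ih c' hc'S hc'C (by simpa [c'] using hw) (by simpa [c'] using hwS) hsum₁
    · have h : c' 1 = c 1 := by
        have : 1 ≠ n + 1 := by omega
        exact Function.update_of_ne this _ _
      exact ih c' hc'S hc'C (by rwa [h]) (by rwa [h]) hsum₁

/-- A homogeneous element `x` with `x ∈ S[x²]` satisfies a homogeneous relation in which its first
power has coefficient `-1`. -/
theorem exists_relation_of_mem_adjoin_sq (hC : IsGradedSubfield C) {S : Subalgebra R K}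
    (hS : HasHomogeneousComponents C (1 : Submodule S K)) {γ : G} {x : K} (hx : x ∈ C γ)
    (hxS : x ∈ Algebra.adjoin S {x ^ 2}) :
    ∃ (n : ℕ) (c : ℕ → K), (∀ i, c i ∈ S) ∧ (∀ i : ℕ, c i ∈ C ((1 - (i : ℤ)) • γ)) ∧ c 1 = -1 ∧
      ∑ i ∈ Finset.range (n + 2), c i * x ^ i = 0 := by
  rw [Algebra.adjoin_singleton_eq_range_aeval] at hxS
  obtain ⟨f, hf⟩ := hxS
  choose p hp hpS hpf using fun i => hS (algebraMap S K (f.coeff i))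
    (Submodule.mem_one.2 ⟨f.coeff i, rfl⟩)
  have hrel : ∑ i ∈ Finset.range (f.natDegree + 1), p i * single γ x ^ (2 * i) = single γ x := by
    refine hC.coeffSum_injOn (sum_mem fun i _ => mul_mem (hp i) (pow_mem (hC.single_mem hx) _))
      (hC.single_mem hx) ?_
    rw [coeffSum_single, map_sum]
    simp only [map_mul, map_pow, coeffSum_single, hpf]
    refine Eq.trans ?_ hf
    change _ = Polynomial.aeval (x ^ 2) f
    rw [Polynomial.aeval_eq_sum_range]
    simp only [Algebra.smul_def, pow_mul]
  -- These are the components that contribute to degree `γ` in `f(x²) = x`.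
  let a : ℕ → K := fun i => (p i).coeff (γ - (2 * i) • γ)
  have ha : ∑ i ∈ Finset.range (f.natDegree + 1), a i * x ^ (2 * i) = x := by
    have := congrArg (fun z => z.coeff γ) hrel
    simp only [coeff_sum, Finsupp.finsetSum_apply, single_pow, coeff_mul_single_apply, coeff_single,
      Finsupp.single_eq_same, ← sub_eq_add_neg] at this
    exact this
  -- Only even powers occur besides `-X`, so the coefficient of the first power is exactly `-1`.
  let q : Polynomial K := ∑ i ∈ Finset.range (f.natDegree + 1), Polynomial.monomial (2 * i) (a i) -
    Polynomial.X
  have hq : ∀ j, q.coeff j = (∑ i ∈ Finset.range (f.natDegree + 1),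
      if 2 * i = j then a i else 0) - if 1 = j then 1 else 0 := by
    intro j
    simp [q, Polynomial.finsetSum_coeff, Polynomial.coeff_monomial, Polynomial.coeff_X]
  refine ⟨q.natDegree, q.coeff, fun j => ?_, fun j => ?_, ?_, ?_⟩
  · rw [hq]
    refine sub_mem (sum_mem fun i _ => ?_) ?_
    · split_ifs
      · exact mem_one_subalgebra.1 (hpS i _)
      · exact zero_mem _
    · split_ifs
      · exact one_mem _
      · exact zero_mem _
  · rw [hq]
    refine sub_mem (sum_mem fun i _ => ?_) ?_
    · split_ifs with h
      · convert hp i _ using 2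
        rw [← h]
        push_cast
        module
      · exact zero_mem _
    · split_ifs with h
      · rw [← h]
        simpa using hC.one_mem_zero
      · exact zero_mem _
  · rw [hq, Finset.sum_eq_zero]
    · simp
    · intro i _
      rw [if_neg (by omega)]
  -- The sum runs one index past the degree of `q`; the extra term vanishes.
  · rw [← Polynomial.eval_eq_sum_range' (Nat.lt_add_of_pos_right two_pos)]
    simp only [q, Polynomial.eval_sub, Polynomial.eval_finsetSum, Polynomial.eval_monomial,
      Polynomial.eval_X, ha, sub_self]

end Relation

theorem mul_mem_one {D K : Type*} [CommRing D] [Field K] [Algebra D K] {a b : K}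
    (ha : a ∈ (1 : Submodule D K)) (hb : b ∈ (1 : Submodule D K)) :
    a * b ∈ (1 : Submodule D K) := by
  simpa using Submodule.mul_mem_mul ha hb

/-! ### Homogeneous localizations and the converse -/

section Backward

open Algebra

variable {Γ R K : Type*} [AddCommMonoid Γ] [IsCancelAdd Γ] [DecidableEq Γ] [CommRing R]
  [IsDomain R] [Field K] [Algebra R K] [IsFractionRing R K] (𝒜 : Γ → AddSubgroup R) [GradedRing 𝒜]

theorem isHomogeneousOverring_adjoin {X : Set K}
    (hX : ∀ x ∈ X, ∃ γ, x ∈ homogeneousQuotientFieldComponent 𝒜 K γ) :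
    IsHomogeneousOverring 𝒜 (Algebra.adjoin R X) := by
  have hC := isGradedSubfield_component (K := K) 𝒜
  rw [isHomogeneousOverring_iff]
  intro x hx
  rw [mem_one_subalgebra] at hx
  induction hx using Algebra.adjoin_induction with
  | mem x hx =>
    obtain ⟨γ, hγ⟩ := hX x hx
    exact HasHomogeneousComponents.of_homogeneous
      (mem_one_subalgebra.2 (Algebra.subset_adjoin hx)) hγ
  | algebraMap r =>
    obtain ⟨p, hp, hp1, hpr, -⟩ := exists_decomposition (K := K) 𝒜 r
    refine ⟨p, hp, fun γ => ?_, hpr⟩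
    obtain ⟨r', hr'⟩ := Submodule.mem_one.1 (hp1 γ)
    rw [← hr', mem_one_subalgebra]
    exact Subalgebra.algebraMap_mem _ r'
  | add x y _ _ hx hy => exact HasHomogeneousComponents.exists_add hx hy
  | mul x y _ _ hx hy =>
    obtain ⟨p, hp, hpT, rfl⟩ := hx
    obtain ⟨q, hq, hqT, rfl⟩ := hy
    refine ⟨p * q, hC.subring.mul_mem hp hq, fun γ => ?_, map_mul _ _ _⟩
    rw [coeff_mul_apply_left]
    refine sum_mem fun δ _ => ?_
    rw [mem_one_subalgebra]
    exact mul_mem (mem_one_subalgebra.1 (hpT _)) (mem_one_subalgebra.1 (hqT _))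

/-- The homogeneous elements of `R` outside a prime submodule `Q`, as elements of `K`. -/
def homogeneousCompl (Q : Submodule R K) (hQ1 : (1 : K) ∉ Q)
    (hQ : ∀ a ∈ (1 : Submodule R K), ∀ b ∈ (1 : Submodule R K), a * b ∈ Q → a ∈ Q ∨ b ∈ Q) :
    Submonoid K where
  carrier := {h | h ∈ (1 : Submodule R K) ∧
    (∃ γ, h ∈ homogeneousQuotientFieldComponent 𝒜 K γ) ∧ h ∉ Q}
  one_mem' := ⟨Submodule.one_mem_one, ⟨0, (isGradedSubfield_component 𝒜).one_mem_zero⟩, hQ1⟩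
  mul_mem' := by
    rintro a b ⟨ha1, ⟨γ, hγ⟩, haQ⟩ ⟨hb1, ⟨δ, hδ⟩, hbQ⟩
    refine ⟨?_, ⟨γ + δ, (isGradedSubfield_component 𝒜).mul_mem_add hγ hδ⟩, fun h => ?_⟩
    · simpa using Submodule.mul_mem_mul ha1 hb1
    · rcases hQ a ha1 b hb1 h with h | h
      · exact haQ h
      · exact hbQ h

variable {𝒜}

section Localization

variable {Q : Submodule R K} {hQ1 : (1 : K) ∉ Q}
  {hQ : ∀ a ∈ (1 : Submodule R K), ∀ b ∈ (1 : Submodule R K), a * b ∈ Q → a ∈ Q ∨ b ∈ Q}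

theorem ne_zero_of_mem_homogeneousCompl {h : K} (hh : h ∈ homogeneousCompl 𝒜 Q hQ1 hQ) :
    h ≠ 0 := by
  rintro rfl
  exact hh.2.2 (zero_mem Q)

theorem inv_homogeneous_of_mem {x : K}
    (hx : x ∈ (fun h => h⁻¹) '' (homogeneousCompl 𝒜 Q hQ1 hQ : Set K)) :
    ∃ γ, x ∈ homogeneousQuotientFieldComponent 𝒜 K γ := by
  obtain ⟨h, hh, rfl⟩ := hx
  obtain ⟨γ, hγ⟩ := hh.2.1
  exact ⟨-γ, (isGradedSubfield_component 𝒜).inv_mem_neg hγ⟩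

theorem mem_adjoin_inv_iff {x : K} :
    x ∈ Algebra.adjoin R ((fun h => h⁻¹) '' (homogeneousCompl 𝒜 Q hQ1 hQ : Set K)) ↔
      ∃ h ∈ homogeneousCompl 𝒜 Q hQ1 hQ, h * x ∈ (1 : Submodule R K) := by
  constructor
  · intro hx
    induction hx using Algebra.adjoin_induction with
    | mem x hx =>
      obtain ⟨h, hh, rfl⟩ := hx
      refine ⟨h, hh, ?_⟩
      rw [mul_inv_cancel₀ (ne_zero_of_mem_homogeneousCompl hh)]
      exact Submodule.one_mem_one
    | algebraMap r => exact ⟨1, one_mem _, by rw [one_mul]; exact Submodule.mem_one.2 ⟨r, rfl⟩⟩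
    | add x y _ _ hx hy =>
      obtain ⟨h, hh, hx⟩ := hx
      obtain ⟨k, hk, hy⟩ := hy
      refine ⟨h * k, mul_mem hh hk, ?_⟩
      have : h * k * (x + y) = k * (h * x) + h * (k * y) := by ring
      rw [this]
      exact add_mem (mul_mem_one hk.1 hx) (mul_mem_one hh.1 hy)
    | mul x y _ _ hx hy =>
      obtain ⟨h, hh, hx⟩ := hx
      obtain ⟨k, hk, hy⟩ := hy
      refine ⟨h * k, mul_mem hh hk, ?_⟩
      rw [mul_mul_mul_comm]
      exact mul_mem_one hx hy
  · rintro ⟨h, hh, hx⟩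
    obtain ⟨r, hr⟩ := Submodule.mem_one.1 hx
    have : x = h⁻¹ * algebraMap R K r := by
      rw [hr, inv_mul_cancel_left₀ (ne_zero_of_mem_homogeneousCompl hh)]
    rw [this]
    exact mul_mem (Algebra.subset_adjoin ⟨h, hh, rfl⟩) (Subalgebra.algebraMap_mem _ r)

/-- The localization at the homogeneous elements outside `Q` is local with respect to elements of
degree zero. -/
theorem inv_mem_or_add_inv_mem {w c : K}
    (hw : w ∈ Algebra.adjoin R ((fun h => h⁻¹) '' (homogeneousCompl 𝒜 Q hQ1 hQ : Set K)))
    (hw0 : w ∈ homogeneousQuotientFieldComponent 𝒜 K 0)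
    (hc : c ∈ Algebra.adjoin R ((fun h => h⁻¹) '' (homogeneousCompl 𝒜 Q hQ1 hQ : Set K)))
    (hc0 : c ∈ homogeneousQuotientFieldComponent 𝒜 K 0) (hcne : c ≠ 0)
    (hcinv : c⁻¹ ∈ Algebra.adjoin R ((fun h => h⁻¹) '' (homogeneousCompl 𝒜 Q hQ1 hQ : Set K))) :
    (w ≠ 0 ∧
      w⁻¹ ∈ Algebra.adjoin R ((fun h => h⁻¹) '' (homogeneousCompl 𝒜 Q hQ1 hQ : Set K))) ∨
    (w + c ≠ 0 ∧
      (w + c)⁻¹ ∈ Algebra.adjoin R ((fun h => h⁻¹) '' (homogeneousCompl 𝒜 Q hQ1 hQ : Set K))) := by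
  have hC := isGradedSubfield_component (K := K) 𝒜
  obtain ⟨h, hh, hhw⟩ := mem_adjoin_inv_iff.1 hw
  obtain ⟨k, hk, hkc⟩ := mem_adjoin_inv_iff.1 hc
  obtain ⟨l, hl, hlc⟩ := mem_adjoin_inv_iff.1 hcinv
  have hhk := mul_mem hh hk
  have ha1 : h * k * w ∈ (1 : Submodule R K) := by
    rw [mul_right_comm]; exact mul_mem_one hhw hk.1
  have hb1 : h * k * c ∈ (1 : Submodule R K) := by
    rw [mul_assoc]; exact mul_mem_one hh.1 hkc
  obtain ⟨δ, hδ⟩ := hhk.2.1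
  have haδ : h * k * w ∈ homogeneousQuotientFieldComponent 𝒜 K δ := by
    simpa using hC.mul_mem_add hδ hw0
  have hbδ : h * k * c ∈ homogeneousQuotientFieldComponent 𝒜 K δ := by
    simpa using hC.mul_mem_add hδ hc0
  -- As `c` is a unit of the localization, `h k c ∈ Q` would put `l h k`, a product of elements
  -- outside `Q`, into `Q`.
  have hbQ : h * k * c ∉ Q := by
    intro hbQ
    obtain ⟨r, hr⟩ := Submodule.mem_one.1 hlc
    have hsm := Q.smul_mem r hbQ
    rw [Algebra.smul_def, hr] at hsm
    have he : l * c⁻¹ * (h * k * c) = l * (h * k) := by field_simp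
    rw [he] at hsm
    exact (mul_mem hl hhk).2.2 hsm
  have key : ∀ z : K, h * k * z ∈ homogeneousCompl 𝒜 Q hQ1 hQ → z ≠ 0 ∧
      z⁻¹ ∈ Algebra.adjoin R ((fun h => h⁻¹) '' (homogeneousCompl 𝒜 Q hQ1 hQ : Set K)) := by
    intro z hz
    have hz0 : z ≠ 0 := right_ne_zero_of_mul (ne_zero_of_mem_homogeneousCompl hz)
    refine ⟨hz0, mem_adjoin_inv_iff.2 ⟨_, hz, ?_⟩⟩
    rw [mul_inv_cancel_right₀ hz0]
    exact hhk.1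
  by_cases haQ : h * k * w ∈ Q
  · right
    refine key _ ?_
    rw [mul_add]
    refine ⟨add_mem ha1 hb1, ⟨δ, add_mem haδ hbδ⟩, fun hab => hbQ ?_⟩
    exact (Submodule.add_mem_iff_right Q haQ).1 hab
  · exact Or.inl (key w ⟨ha1, ⟨δ, haδ⟩, haQ⟩)

/-- If `F^⋆ = R^⋆`, then `F ⊄ Q`, since otherwise `1 ∈ Q^{⋆_f}`. So the homogeneous ideal `F` has a
homogeneous element outside `Q`, which is inverted in the overring. -/
theorem isHomogeneouslyLinked_adjoin {s : SemistarOperation R K} (hQs : (1 : K) ∉ s.finiteType Q)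
    {X : Set K} (hX : ∀ x ∈ X, ∃ γ, x ∈ homogeneousQuotientFieldComponent 𝒜 K γ)
    (hPX : (fun h => h⁻¹) '' (homogeneousCompl 𝒜 Q hQ1 hQ : Set K) ⊆ X) :
    IsHomogeneouslyLinked 𝒜 s (Algebra.adjoin R X)
      (SemistarOperation.d (Algebra.adjoin R X) K) := by
  refine ⟨isHomogeneousOverring_adjoin 𝒜 hX, fun F hF0 hFfg hFh hFs => ?_⟩
  obtain ⟨f, hfF, ⟨α, hα⟩, hfQ⟩ : ∃ f ∈ F, SetLike.IsHomogeneousElem 𝒜 f ∧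
      algebraMap R K f ∉ Q := by
    by_contra! hcon
    have hFQ : IsLocalization.coeSubmodule K F ≤ Q := by
      refine (IsLocalization.coeSubmodule_mono K hFh.le_span).trans ?_
      rw [IsLocalization.coeSubmodule_span, Submodule.span_le]
      rintro _ ⟨f, hf, rfl⟩
      exact hcon f hf.1 hf.2
    refine hQs ⟨_, (IsLocalization.coeSubmodule_fg K (IsFractionRing.injective R K) F).2 hFfg, hFQ,
      ?_⟩
    rw [hFs]
    exact s.le_self 1 Submodule.one_mem_one
  have hfP : algebraMap R K f ∈ homogeneousCompl 𝒜 Q hQ1 hQ :=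
    ⟨Submodule.mem_one.2 ⟨f, rfl⟩, ⟨_, algebraMap_mem_component 𝒜 hα⟩, hfQ⟩
  have hinv : (algebraMap R K f)⁻¹ ∈ Algebra.adjoin R X :=
    Algebra.subset_adjoin (hPX ⟨_, hfP, rfl⟩)
  have htop : F.map (algebraMap R (Algebra.adjoin R X)) = ⊤ := by
    rw [Ideal.eq_top_iff_one]
    have h1 : (⟨_, hinv⟩ : Algebra.adjoin R X) * algebraMap R (Algebra.adjoin R X) f = 1 :=
      Subtype.ext (inv_mul_cancel₀ (ne_zero_of_mem_homogeneousCompl hfP))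
    rw [← h1]
    exact Ideal.mul_mem_left _ _ (Ideal.mem_map_of_mem _ hfF)
  rw [htop, IsLocalization.coeSubmodule_top]

/-- If all homogeneously linked overrings are integrally closed, the localization at the homogeneous
elements outside `Q` is a graded valuation domain. -/
theorem mem_or_inv_mem_adjoin_inv {s : SemistarOperation R K} (hQs : (1 : K) ∉ s.finiteType Q)
    (hint : ∀ T : Subalgebra R K, IsHomogeneouslyLinked 𝒜 s T (SemistarOperation.d T K) →
      IsIntegrallyClosed T)
    {γ : GrothendieckAddGroup Γ} {x : K} (hx : x ∈ homogeneousQuotientFieldComponent 𝒜 K γ) :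
    x ∈ Algebra.adjoin R ((fun h => h⁻¹) '' (homogeneousCompl 𝒜 Q hQ1 hQ : Set K)) ∨
      x⁻¹ ∈ Algebra.adjoin R ((fun h => h⁻¹) '' (homogeneousCompl 𝒜 Q hQ1 hQ : Set K)) := by
  have hC := isGradedSubfield_component (K := K) 𝒜
  set P := (fun h => h⁻¹) '' (homogeneousCompl 𝒜 Q hQ1 hQ : Set K) with hP
  have hPh : ∀ x ∈ P, ∃ γ, x ∈ homogeneousQuotientFieldComponent 𝒜 K γ :=
    fun x hx => inv_homogeneous_of_mem hx
  have hS : IsIntegrallyClosed (Algebra.adjoin R P) :=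
    hint _ (isHomogeneouslyLinked_adjoin hQs hPh subset_rfl)
  have hT : IsIntegrallyClosed (Algebra.adjoin R (P ∪ {x ^ 2})) := by
    refine hint _ (isHomogeneouslyLinked_adjoin hQs ?_ Set.subset_union_left)
    rintro y (hy | rfl)
    · exact hPh y hy
    · exact ⟨γ + γ, by rw [pow_two]; exact hC.mul_mem_add hx hx⟩
  -- `x` is integral over a ring containing `x²`.
  have hxT : x ∈ Algebra.adjoin R (P ∪ {x ^ 2}) := by
    have hsq : IsIntegral (Algebra.adjoin R (P ∪ {x ^ 2})) (x ^ 2) := by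
      have := isIntegral_algebraMap (R := Algebra.adjoin R (P ∪ {x ^ 2})) (A := K)
        (x := ⟨x ^ 2, Algebra.subset_adjoin (Or.inr rfl)⟩)
      exact this
    obtain ⟨y, hy⟩ := IsIntegrallyClosed.isIntegral_iff.1 (hsq.of_pow two_pos)
    have hyT := y.2
    rwa [show (y : K) = x from hy] at hyT
  rw [Algebra.adjoin_union_eq_adjoin_adjoin, Subalgebra.mem_restrictScalars] at hxT
  obtain ⟨n, c, hcS, hcC, hc1, hsum⟩ := exists_relation_of_mem_adjoin_sq hC
    ((isHomogeneousOverring_iff 𝒜).1 (isHomogeneousOverring_adjoin 𝒜 hPh)) hx hxT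
  refine mem_or_inv_mem_of_sum_eq_zero hC ?_ hx n c hcS hcC (by simp [hc1]) ?_ hsum
  · intro w hw hw0 c hc hc0 hcne hcinv
    exact inv_mem_or_add_inv_mem hw hw0 hc hc0 hcne hcinv
  · rw [hc1, inv_neg, inv_one]
    exact neg_mem (one_mem _)

end Localization

/-- Finitely many elements of a subalgebra that contains `x` or `x⁻¹` for all quotients `x` of these
elements have one among them that divides the others. -/
theorem exists_forall_div_mem {R K : Type*} [CommRing R] [Field K] [Algebra R K]
    {S : Subalgebra R K} {Y : Finset K} (hY : Y.Nonempty) (h0 : (0 : K) ∉ Y)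
    (h : ∀ a ∈ Y, ∀ b ∈ Y, a / b ∈ S ∨ b / a ∈ S) : ∃ a ∈ Y, ∀ b ∈ Y, b / a ∈ S := by
  classical
  induction hY using Finset.Nonempty.cons_induction with
  | singleton a =>
    refine ⟨a, by simp, fun b hb => ?_⟩
    rw [Finset.mem_singleton] at hb h0
    rw [hb, div_self (Ne.symm h0)]
    exact one_mem _
  | cons a Y ha hY ih =>
    simp only [Finset.mem_cons, not_or] at h0
    obtain ⟨c, hc, hcY⟩ := ih h0.2 fun a ha b hb =>
      h a (Finset.mem_cons_of_mem ha) b (Finset.mem_cons_of_mem hb)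
    have hc0 : c ≠ 0 := fun h => h0.2 (h ▸ hc)
    rcases h a (Finset.mem_cons_self a Y) c (Finset.mem_cons_of_mem hc) with hac | hca
    · refine ⟨c, Finset.mem_cons_of_mem hc, fun b hb => ?_⟩
      rcases Finset.mem_cons.1 hb with rfl | hb
      · exact hac
      · exact hcY b hb
    · refine ⟨a, Finset.mem_cons_self a Y, fun b hb => ?_⟩
      rcases Finset.mem_cons.1 hb with rfl | hb
      · rw [div_self (Ne.symm h0.1)]
        exact one_mem _
      · rw [← div_mul_div_cancel₀ hc0]
        exact mul_mem (hcY b hb) hca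

theorem isGradedPStarMD_of_linked_isIntegrallyClosed {s : SemistarOperation R K}
    (hint : ∀ T : Subalgebra R K, IsHomogeneouslyLinked 𝒜 s T (SemistarOperation.d T K) →
      IsIntegrallyClosed T) : IsGradedPStarMD 𝒜 s := by
  classical
  intro I hfg hI0 hI
  have hC := isGradedSubfield_component (K := K) 𝒜
  obtain ⟨S, hS, rfl⟩ := hI.exists_finset hfg
  set E := IsLocalization.coeSubmodule K (Ideal.span (S : Set R)) with hE
  let Y : Finset K := (S.image (algebraMap R K)).erase 0
  have hYE : Submodule.span R (Y : Set K) = E := by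
    rw [hE, IsLocalization.coeSubmodule_span, Finset.coe_erase, Finset.coe_image,
      Submodule.span_sdiff_singleton_zero]
  have hYne : Y.Nonempty := by
    rw [Finset.nonempty_iff_ne_empty]
    intro h
    rw [h, Finset.coe_empty, Submodule.span_empty, hE] at hYE
    exact hI0 (IsFractionRing.coeSubmodule_injective R K
      (hYE.symm.trans (IsLocalization.coeSubmodule_bot K).symm))
  have hYh : ∀ y ∈ Y, ∃ γ, y ∈ homogeneousQuotientFieldComponent 𝒜 K γ := by
    intro y hy
    obtain ⟨r, hr, rfl⟩ := Finset.mem_image.1 (Finset.mem_of_mem_erase hy)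
    obtain ⟨α, hα⟩ := hS r hr
    exact ⟨_, algebraMap_mem_component 𝒜 hα⟩
  rw [isStarInvertible_iff]
  by_contra hcon
  obtain ⟨Q, hJQ, hQs, hQ⟩ := s.exists_prime_of_one_notMem (Submodule.mul_one_div_self_le E) hcon
  have hQ1 : (1 : K) ∉ Q := fun h => hQs (s.finiteType.le_self Q h)
  obtain ⟨a, haY, ha⟩ := exists_forall_div_mem
    (S := Algebra.adjoin R ((fun h => h⁻¹) '' (homogeneousCompl 𝒜 Q hQ1 hQ : Set K)))
    hYne (Finset.notMem_erase _ _) (by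
      intro a ha b hb
      obtain ⟨γ, hγ⟩ := hYh a ha
      obtain ⟨δ, hδ⟩ := hYh b hb
      have := mem_or_inv_mem_adjoin_inv (hQ1 := hQ1) (hQ := hQ) hQs hint
        (hC.mul_mem_add hγ (hC.inv_mem_neg hδ))
      rwa [← div_eq_mul_inv, inv_div] at this)
  have ha0 : a ≠ 0 := Finset.ne_of_mem_erase haY
  -- One denominator outside `Q` serves all quotients `b / a`.
  have hden : ∀ Z : Finset K, Z ⊆ Y → ∃ h ∈ homogeneousCompl 𝒜 Q hQ1 hQ,
      ∀ b ∈ Z, h * (b / a) ∈ (1 : Submodule R K) := by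
    intro Z
    induction Z using Finset.induction_on with
    | empty => exact fun _ => ⟨1, one_mem _, by simp⟩
    | insert b Z _ ih =>
      intro hZ
      obtain ⟨h, hh, hhZ⟩ := ih ((Finset.subset_insert b Z).trans hZ)
      obtain ⟨k, hk, hkb⟩ := mem_adjoin_inv_iff.1 (ha b (hZ (Finset.mem_insert_self b Z)))
      refine ⟨h * k, mul_mem hh hk, fun c hc => ?_⟩
      rcases Finset.mem_insert.1 hc with rfl | hc
      · rw [mul_assoc]
        exact mul_mem_one hh.1 hkb
      · rw [mul_right_comm]
        exact mul_mem_one (hhZ c hc) hk.1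
  obtain ⟨h, hh, hhY⟩ := hden Y subset_rfl
  -- Since `h / a ∈ E⁻¹`, the element `h = a (h / a)` lies in `E E⁻¹ ⊆ Q`, although `h ∉ Q`.
  refine hh.2.2 (hJQ ?_)
  rw [← mul_div_cancel₀ h ha0, ← hYE]
  refine Submodule.mul_mem_mul (Submodule.subset_span haY) (Submodule.mem_one_div_span.2 ?_)
  intro b hb
  rw [div_mul_eq_mul_div, mul_div_assoc]
  exact hhY b hb

end Backward

/-- For `d`, linkedness means `F T = T`, and then the `t`-closures agree. -/
theorem IsHomogeneouslyLinked.t_of_d {Γ R K : Type*} [AddCommMonoid Γ] [IsCancelAdd Γ] [CommRing R]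
    [IsDomain R] [Field K] [Algebra R K] [IsFractionRing R K] {𝒜 : Γ → AddSubgroup R}
    [SetLike.GradedMonoid 𝒜] {s : SemistarOperation R K} {T : Subalgebra R K}
    (hT : IsHomogeneouslyLinked 𝒜 s T (SemistarOperation.d T K)) :
    IsHomogeneouslyLinked 𝒜 s T (SemistarOperation.t T K) :=
  ⟨hT.isHomogeneousOverring, fun F hF0 hFfg hFh hFs =>
    congrArg (SemistarOperation.t T K) (hT.linked F hF0 hFfg hFh hFs)⟩

theorem theorem4p7 {Γ R K : Type*} [AddCommMonoid Γ] [IsCancelAdd Γ] [IsAddTorsionFree Γ]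
    [DecidableEq Γ] [CommRing R] [IsDomain R] [Field K] [Algebra R K] [IsFractionRing R K]
    (𝒜 : Γ → AddSubgroup R) [GradedRing 𝒜]
    (hunit : ∃ α : Γ, α ≠ 0 ∧ ∃ u ∈ 𝒜 α, IsUnit u)
    (s : SemistarOperation R K)
    (hs : s 1 < Subalgebra.toSubmodule (homogeneousQuotientField 𝒜 K)) :
    List.TFAE [
      IsGradedPStarMD 𝒜 s,
      ∀ T : Subalgebra R K, IsHomogeneouslyLinked 𝒜 s T (SemistarOperation.t T K) → IsPvMD T K,
      ∀ T : Subalgebra R K, IsHomogeneouslyLinked 𝒜 s T (SemistarOperation.d T K) →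
        IsGradedPrufer K (overringComponent 𝒜 T),
      ∀ T : Subalgebra R K, IsHomogeneouslyLinked 𝒜 s T (SemistarOperation.t T K) →
        IsIntegrallyClosed T,
      ∀ T : Subalgebra R K, IsHomogeneouslyLinked 𝒜 s T (SemistarOperation.d T K) →
        IsIntegrallyClosed T] := by
  tfae_have 1 → 2 := fun h _ hT => h.isPvMD_of_linked hT
  tfae_have 1 → 3 := fun h _ hT => h.isGradedPrufer_of_linked hT
  tfae_have 2 → 4 := fun h T hT => (h T hT).isIntegrallyClosed
  tfae_have 3 → 5 := fun h T hT => (h T hT).isIntegrallyClosed_overring hT.isHomogeneousOverring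
  tfae_have 4 → 5 := fun h T hT => h T hT.t_of_d
  tfae_have 5 → 1 := isGradedPStarMD_of_linked_isIntegrallyClosed
  tfae_finish
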